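/- **Definitions.** All Banach spaces are complex, and $F\hookrightarrow E$ means that $F$ is a subspace of $E$ (as a vector space) with continuous inclusion. For an operator $K$ on $E$, $[D(K)]$ is its domain with the graph norm. A *cosine operator function* on a Banach space $E$ is a strongly continuous map $C:\mathbb R\to\mathcal L(E)$ with $C(0)=I_E$ and $C(t+s)+C(t-s)=2C(t)C(s)$ for all $t,s\in\mathbb R$. Its generator is the operator $Kx=\lim_{t\to0}\frac{2}{t^2}(C(t)x-x)$, whose domain is the set of all $x\in E$ for which the limit exists. We say that $K$ *generates a cosine operator function with associated phase space $F\times E$* if $K$ is the generator of a cosine operator function on $E$ and $F$ is a Banach space with dense continuous embeddings $[D(K)]\hookrightarrow F\hookrightarrow E$ such that the operator matrix $\begin{pmatrix}0&I_F\\K&0\end{pmatrix}$ with domain $D(K)\times F$ generates a strongly continuous semigroup on $F\times E$. **Setting.** Let $X,Y,V,\partial X$ be Banach spaces with $V\hookrightarrow Y\hookrightarrow X$. Let $A:D(A)\to X$ be linear with $D(A)\subset Y$ (where $D(A)$ is a subspace of $X$), and let $L:D(A)\to\partial X$ be linear and surjective. Assume that $A_0:=A|_{\ker L}$ is closed, densely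 defined in $X$ and has nonempty resolvent set $\rho(A_0)$, and that $\begin{pmatrix}A\\L\end{pmatrix}:D(A)\to X\times\partial X$ is closed. Let $B:D(A)\to\partial X$ be linear and bounded with respect to the norm $\|u\|_X+\|Au\|_X+\|Lu\|_{\partial X}$ on $D(A)$, and let $\tilde B\in\mathcal L(\partial X)$. Finally, assume that $L$ extends to a bounded operator $Y\to\partial X$, again denoted by $L$, whose kernel is $V$. For $\lambda\in\rho(A_0)$ the restriction of $L$ to $\ker(\lambda-A)$ is a bijection onto $\partial X$; let $D^A_\lambda:\partial X\to\ker(\lambda-A)$ be its inverse. Consider $A_0-D^A_\lambda B$ as an operator on $X$ with domain $D(A_0)$. On $\mathcal X:=X\times\partial X$ let $$\mathcal A:=\begin{pmatrix}A&0\\B&\tilde B\end{pmatrix},\qquad D(\mathcal A):=\left\{\begin{pmatrix}u\\x\end{pmatrix}\in D(A)\times\partial X: Lu=x\right\},$$ and let $$\mathcal V:=\left\{\begin{pmatrix}u\\x\end{pmatrix}\in Y\times\partial X: Lu=x\right\}$$ be endowed with the norm of $Y\times\partial X$. **Theorem.** For every $\lambda\in\rho(A_0)$, the operator $\mathcal A$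 generates a cosine operator function with associated phase space $\mathcal V\times\mathcal X$ if and only if $A_0-D^A_\lambda B$ generates a cosine operator function with associated phase space $V\times X$. -/

import Mathlib

open Filter Topology

namespace AIBVP

section Cosine

/-! ## Cosine operator functions, strongly continuous semigroups, Kisyński spaces -/

/-- Cosine operator functions on `E`: strongly continuous maps `C : ℝ → 𝓛(E)` satisfying
D'Alembert's functional equation and `C 0 = I`. -/
structure IsCosineFunction {E : Type*} [NormedAddCommGroup E] [NormedSpace ℂ E]
    (C : ℝ → E →L[ℂ] E) : Prop where
  strong_continuous : ∀ x : E, Continuous fun t : ℝ => C t x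
  dalembert : ∀ t s : ℝ, C (t + s) + C (t - s) = (2 : ℂ) • (C t * C s)
  map_zero : C 0 = 1

/-- `K` is the generator of the cosine operator function `C`: `x ∈ D(K)` and `K x = y` if and only
if `(2 / t²) (C(t) x - x)` converges to `y` as `t → 0`. -/
def IsCosineGenerator {E : Type*} [NormedAddCommGroup E] [NormedSpace ℂ E]
    (K : E →ₗ.[ℂ] E) (C : ℝ → E →L[ℂ] E) : Prop :=
  ∀ x y : E, (x, y) ∈ K.graph ↔
    Tendsto (fun t : ℝ => (2 / t ^ 2 : ℝ) • (C t x - x)) (𝓝[≠] 0) (𝓝 y)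

/-- The operator `K` on the Banach space `E` generates a cosine operator function. -/
def GeneratesCosine {E : Type*} [NormedAddCommGroup E] [NormedSpace ℂ E]
    (K : E →ₗ.[ℂ] E) : Prop :=
  ∃ C : ℝ → E →L[ℂ] E, IsCosineFunction C ∧ IsCosineGenerator K C

/-- Strongly continuous semigroups `(T(t))_{t ≥ 0}`. The values of `T` at negative times
are irrelevant. -/
structure IsC0Semigroup {E : Type*} [NormedAddCommGroup E] [NormedSpace ℂ E]
    (T : ℝ → E →L[ℂ] E) : Prop where
  strong_continuous : ∀ x : E, ContinuousOn (fun t : ℝ => T t x) (Set.Ici 0)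
  map_add : ∀ t s : ℝ, 0 ≤ t → 0 ≤ s → T (t + s) = T t * T s
  map_zero : T 0 = 1

/-- `G` is the generator of the semigroup `T`: `x ∈ D(G)` and `G x = y` if and only if
`t⁻¹ (T(t) x - x)` converges to `y` as `t → 0+`. -/
def IsSemigroupGenerator {E : Type*} [NormedAddCommGroup E] [NormedSpace ℂ E]
    (G : E →ₗ.[ℂ] E) (T : ℝ → E →L[ℂ] E) : Prop :=
  ∀ x y : E, (x, y) ∈ G.graph ↔
    Tendsto (fun t : ℝ => (t⁻¹ : ℝ) • (T t x - x)) (𝓝[>] 0) (𝓝 y)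

/-- The operator `G` on the Banach space `E` generates a strongly continuous semigroup. -/
def GeneratesC0Semigroup {E : Type*} [NormedAddCommGroup E] [NormedSpace ℂ E]
    (G : E →ₗ.[ℂ] E) : Prop :=
  ∃ T : ℝ → E →L[ℂ] E, IsC0Semigroup T ∧ IsSemigroupGenerator G T

/-- The reduction matrix `[[0, I_F], [K, 0]]` on `F × E` with domain `D(K) × F`, where `F` is
regarded as a subspace of `E` through the injection `ι : F → E`. -/
noncomputable def reductionMatrix {E F : Type*} [NormedAddCommGroup E] [NormedSpace ℂ E]
    [NormedAddCommGroup F] [NormedSpace ℂ F]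
    (K : E →ₗ.[ℂ] E) (ι : F →L[ℂ] E) (hι : Function.Injective ι) :
    (F × E) →ₗ.[ℂ] (F × E) where
  domain := (K.domain.comap (ι : F →ₗ[ℂ] E)).prod (LinearMap.range (ι : F →ₗ[ℂ] E))
  toFun :=
    { toFun := fun p =>
        ((LinearEquiv.ofInjective (ι : F →ₗ[ℂ] E) hι).symm ⟨p.1.2, p.2.2⟩,
          K ⟨ι p.1.1, p.2.1⟩)
      map_add' := fun p q => by
        refine Prod.ext ?_ ?_
        · exact map_add (LinearEquiv.ofInjective (ι : F →ₗ[ℂ] E) hι).symm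
            ⟨p.1.2, p.2.2⟩ ⟨q.1.2, q.2.2⟩
        · refine Eq.trans ?_ (K.map_add ⟨ι p.1.1, p.2.1⟩ ⟨ι q.1.1, q.2.1⟩)
          exact congrArg K (Subtype.ext (map_add ι _ _))
      map_smul' := fun c p => by
        refine Prod.ext ?_ ?_
        · exact map_smul (LinearEquiv.ofInjective (ι : F →ₗ[ℂ] E) hι).symm c
            ⟨p.1.2, p.2.2⟩
        · refine Eq.trans ?_ (K.map_smul c ⟨ι p.1.1, p.2.1⟩)
          exact congrArg K (Subtype.ext (map_smul ι _ _)) }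

/-- `K` generates a cosine operator function on the Banach space `E` with associated phase space
`F × E`. The Kisyński space `F` is a Banach space given together with its embedding `ι : F → E`;
there are dense continuous embeddings `[D(K)] ↪ F ↪ E`, where `[D(K)]` carries the graph norm,
and the reduction matrix generates a strongly continuous semigroup on `F × E`. -/
structure GeneratesCosineWithPhaseSpace {E F : Type*}
    [NormedAddCommGroup E] [NormedSpace ℂ E] [CompleteSpace E]
    [NormedAddCommGroup F] [NormedSpace ℂ F] [CompleteSpace F]
    (K : E →ₗ.[ℂ] E) (ι : F →L[ℂ] E) : Prop where
  generates_cosine : GeneratesCosine K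
  injective : Function.Injective ι
  denseRange : DenseRange ι
  domain_le : K.domain ≤ LinearMap.range (ι : F →ₗ[ℂ] E)
  domain_bound : ∃ c : ℝ, ∀ (f : F) (hf : ι f ∈ K.domain), ‖f‖ ≤ c * (‖ι f‖ + ‖K ⟨ι f, hf⟩‖)
  domain_dense : Dense {f : F | ι f ∈ K.domain}
  generates_semigroup : GeneratesC0Semigroup (reductionMatrix K ι injective)

end Cosine

section Resolvent

/-- The resolvent set of an operator `T` on `E`: all `μ` such that `μ - T : D(T) → E` has a
bounded everywhere defined inverse `R`. -/
def resolventSet {E : Type*} [NormedAddCommGroup E] [NormedSpace ℂ E]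
    (T : E →ₗ.[ℂ] E) : Set ℂ :=
  {μ | ∃ R : E →L[ℂ] E,
    (∀ x : E, ∃ h : R x ∈ T.domain, μ • R x - T ⟨R x, h⟩ = x) ∧
    (∀ u : T.domain, R (μ • (u : E) - T u) = u)}

end Resolvent

section Boundary

variable {X dX Y : Type*} [NormedAddCommGroup X] [NormedSpace ℂ X]
  [NormedAddCommGroup dX] [NormedSpace ℂ dX] [NormedAddCommGroup Y] [NormedSpace ℂ Y]

/-! ## The operators of the abstract boundary value problem

`A : D(A) → X` is an operator on `X` and `L : D(A) → ∂X` the boundary operator. -/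

/-- The column operator `(A, L) : D(A) → X × ∂X`. -/
def column (A : X →ₗ.[ℂ] X) (L : A.domain →ₗ[ℂ] dX) : X →ₗ.[ℂ] (X × dX) where
  domain := A.domain
  toFun := A.toFun.prod L

/-- `ker L`, as a subspace of `X`. -/
def kerDomain (A : X →ₗ.[ℂ] X) (L : A.domain →ₗ[ℂ] dX) : Submodule ℂ X :=
  (LinearMap.ker L).map A.domain.subtype

theorem kerDomain_le (A : X →ₗ.[ℂ] X) (L : A.domain →ₗ[ℂ] dX) :
    kerDomain A L ≤ A.domain :=
  Submodule.map_subtype_le _ _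

/-- The restriction `A₀` of `A` to `ker L`. -/
def restrictKer (A : X →ₗ.[ℂ] X) (L : A.domain →ₗ[ℂ] dX) : X →ₗ.[ℂ] X where
  domain := kerDomain A L
  toFun := A.toFun ∘ₗ Submodule.inclusion (kerDomain_le A L)

/-- `ker (μ - A)`, as a subspace of `D(A)`. -/
def eigenKer (A : X →ₗ.[ℂ] X) (μ : ℂ) : Submodule ℂ A.domain :=
  LinearMap.ker (μ • A.domain.subtype - A.toFun)

/-- For `μ ∈ ρ(A₀)` and `L` surjective, `L` maps `ker (μ - A)` bijectively onto `∂X`. -/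
theorem bijective_restrict_eigenKer (A : X →ₗ.[ℂ] X) (L : A.domain →ₗ[ℂ] dX)
    (hL : Function.Surjective L) {μ : ℂ} (hμ : μ ∈ resolventSet (restrictKer A L)) :
    Function.Bijective (L ∘ₗ (eigenKer A μ).subtype) := by
  obtain ⟨R, hR1, hR2⟩ := hμ
  constructor
  · rw [← LinearMap.ker_eq_bot, LinearMap.ker_eq_bot']
    rintro ⟨u, hu⟩ hLu
    have hLu' : L u = 0 := hLu
    have hu' : μ • (u : X) - A u = 0 := hu
    have hmem : (u : X) ∈ kerDomain A L := ⟨u, hLu', rfl⟩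
    have h := hR2 ⟨(u : X), hmem⟩
    have h2 : μ • (u : X) - (restrictKer A L) ⟨(u : X), hmem⟩ = 0 := hu'
    simp only [h2, map_zero] at h
    exact Subtype.ext (Subtype.ext h.symm)
  · intro x
    obtain ⟨u, rfl⟩ := hL x
    obtain ⟨hv, hv2⟩ := hR1 (μ • (u : X) - A u)
    obtain ⟨v, hv0, hv1⟩ := hv
    have hv0' : L v = 0 := hv0
    have hv1' : (v : X) = R (μ • (u : X) - A u) := hv1
    have key : μ • (v : X) - A v = μ • (u : X) - A u := by
      refine Eq.trans ?_ hv2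
      exact congrArg₂ (fun a b : X => μ • a - b) hv1' (congrArg A (Subtype.ext hv1'))
    refine ⟨⟨u - v, ?_⟩, ?_⟩
    · change μ • ((u : X) - (v : X)) - A (u - v) = 0
      rw [A.map_sub, smul_sub]
      rw [sub_sub_sub_comm, key, sub_self]
    · change L (u - v) = L u
      rw [map_sub, hv0', sub_zero]

/-- The Dirichlet operator `D_μ : ∂X → ker (μ - A) ⊆ D(A)`, the inverse of the restriction of `L`
to `ker (μ - A)`, for `μ ∈ ρ(A₀)`. -/
noncomputable def dirichlet (A : X →ₗ.[ℂ] X) (L : A.domain →ₗ[ℂ] dX)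
    (hL : Function.Surjective L) {μ : ℂ} (hμ : μ ∈ resolventSet (restrictKer A L)) :
    dX →ₗ[ℂ] A.domain :=
  (eigenKer A μ).subtype ∘ₗ
    ((LinearEquiv.ofBijective (L ∘ₗ (eigenKer A μ).subtype)
      (bijective_restrict_eigenKer A L hL hμ)).symm : dX →ₗ[ℂ] eigenKer A μ)

/-- The operator `A₀ - D_μ B` on `X`, with domain `D(A₀)`. -/
noncomputable def perturbed (A : X →ₗ.[ℂ] X) (L : A.domain →ₗ[ℂ] dX)
    (hL : Function.Surjective L) (B : A.domain →ₗ[ℂ] dX)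
    {μ : ℂ} (hμ : μ ∈ resolventSet (restrictKer A L)) : X →ₗ.[ℂ] X where
  domain := kerDomain A L
  toFun := (show kerDomain A L →ₗ[ℂ] X from (restrictKer A L).toFun) -
    A.domain.subtype ∘ₗ dirichlet A L hL hμ ∘ₗ B ∘ₗ Submodule.inclusion (kerDomain_le A L)

/-- The operator matrix `[[A, 0], [B, B̃]]` on `X × ∂X` with coupled domain
`{(u, x) ∈ D(A) × ∂X | L u = x}`. -/
def operatorMatrix (A : X →ₗ.[ℂ] X) (L : A.domain →ₗ[ℂ] dX) (B : A.domain →ₗ[ℂ] dX)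
    (Bt : dX →L[ℂ] dX) : (X × dX) →ₗ.[ℂ] (X × dX) where
  domain :=
    { carrier := {p | ∃ h : p.1 ∈ A.domain, L ⟨p.1, h⟩ = p.2}
      add_mem' := by
        rintro p q ⟨hp, hp'⟩ ⟨hq, hq'⟩
        exact ⟨A.domain.add_mem hp hq,
          (map_add L ⟨p.1, hp⟩ ⟨q.1, hq⟩).trans (congrArg₂ (· + ·) hp' hq')⟩
      zero_mem' := ⟨A.domain.zero_mem, map_zero L⟩
      smul_mem' := by
        rintro c p ⟨hp, hp'⟩
        exact ⟨A.domain.smul_mem c hp,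
          (map_smul L c ⟨p.1, hp⟩).trans (congrArg (c • ·) hp')⟩ }
  toFun :=
    { toFun := fun p =>
        (A ⟨p.1.1, p.2.fst⟩, B ⟨p.1.1, p.2.fst⟩ + Bt p.1.2)
      map_add' := fun p q => by
        refine Prod.ext ?_ ?_
        · exact A.map_add ⟨p.1.1, p.2.fst⟩ ⟨q.1.1, q.2.fst⟩
        · refine Eq.trans (congrArg₂ (· + ·)
            (map_add B ⟨p.1.1, p.2.fst⟩ ⟨q.1.1, q.2.fst⟩) (map_add Bt p.1.2 q.1.2)) ?_
          exact add_add_add_comm _ _ _ _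
      map_smul' := fun c p => by
        refine Prod.ext ?_ ?_
        · exact A.map_smul c ⟨p.1.1, p.2.fst⟩
        · refine Eq.trans (congrArg₂ (· + ·)
            (map_smul B c ⟨p.1.1, p.2.fst⟩) (map_smul Bt c p.1.2)) ?_
          exact (smul_add _ _ _).symm }

/-- The space `{(u, x) ∈ Y × ∂X | L u = x}`, with the norm inherited from `Y × ∂X`. -/
def coupledSpace (L : Y →L[ℂ] dX) : Submodule ℂ (Y × dX) where
  carrier := {p | L p.1 = p.2}
  add_mem' := by
    rintro p q hp hq
    exact (map_add L p.1 q.1).trans (congrArg₂ (· + ·) hp hq)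
  zero_mem' := map_zero L
  smul_mem' := by
    rintro c p hp
    exact (map_smul L c p.1).trans (congrArg (c • ·) hp)

instance instCompleteSpaceCoupledSpace [CompleteSpace Y] [CompleteSpace dX]
    (L : Y →L[ℂ] dX) : CompleteSpace (coupledSpace L) := by
  have h : IsClosed {p : Y × dX | L p.1 = p.2} :=
    isClosed_eq (L.continuous.comp continuous_fst) continuous_snd
  exact IsClosed.completeSpace_coe (s := {p : Y × dX | L p.1 = p.2}) (hs := h)

/-- The embedding of the coupled space into `X × ∂X`, given the embedding `i : Y → X`. -/
noncomputable def coupledEmbedding (i : Y →L[ℂ] X) (L : Y →L[ℂ] dX) :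
    coupledSpace L →L[ℂ] X × dX :=
  (i.prodMap (ContinuousLinearMap.id ℂ dX)).comp (coupledSpace L).subtypeL

end Boundary

end AIBVP

/-! Let `D` be the Dirichlet operator, `N = B D` and `H = A₀ - D B`. The shear `Ψ (v, x) = (v + D x,
x)` decouples the boundary condition, since `L (v + D x) = x` exactly when `L v = 0`. As `A D = μ
D`, conjugating the operator matrix by `Ψ` gives `[[H, μ D - D (N + B̃)], [B, N + B̃]]` on `D(A₀) ×
∂X`, whose second column is bounded. The same shear identifies `V × ∂X` with the coupled space,
because `D` is bounded into `Y` and `ker L = V`.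

Generation with a given phase space is invariant under similarity
(`GeneratesCosineWithPhaseSpace.similar_iff`) and under bounded perturbation
(`GeneratesCosineWithPhaseSpace.perturb_iff`), so only `[[H, 0], [B, 0]]` remains. Here `B` is
unbounded, but `B` composed with a resolvent of `H` is bounded, and a second shear by that operator
trades `B` for a bounded term (`generatesCosineWithPhaseSpace_firstColumn_iff`).

Both invariances are proved for the semigroup of the reduction matrix. This suffices by
`generatesCosineWithPhaseSpace_iff`: the cosine function, the densities and the norm bound all
follow from that semigroup. -/

namespace AIBVP

/-! ### Strongly continuous semigroups and their generators. -/

section Semigroup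

variable {E : Type*} [NormedAddCommGroup E] [NormedSpace ℂ E]
  {E' : Type*} [NormedAddCommGroup E'] [NormedSpace ℂ E']

/-- `y` is the value at `x` of the infinitesimal generator of `T`. -/
def InfGen (T : ℝ → E →L[ℂ] E) (x y : E) : Prop :=
  Tendsto (fun t : ℝ => (t⁻¹ : ℝ) • (T t x - x)) (𝓝[>] 0) (𝓝 y)

theorem InfGen.smul {T : ℝ → E →L[ℂ] E} {x y : E} (h : InfGen T x y) (c : ℝ) :
    InfGen T (c • x) (c • y) := by
  refine (Tendsto.const_smul h c).congr fun t => ?_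
  rw [ContinuousLinearMap.map_smul_of_tower, ← smul_sub, smul_comm]

theorem InfGen.map {T : ℝ → E →L[ℂ] E} {T' : ℝ → E' →L[ℂ] E'} {x y : E} (h : InfGen T x y)
    (Q : E →L[ℂ] E') (hQ : ∀ t, 0 < t → Q (T t x) = T' t (Q x)) : InfGen T' (Q x) (Q y) := by
  refine ((Q.continuous.tendsto y).comp h).congr' ?_
  filter_upwards [self_mem_nhdsWithin] with t ht
  simp only [Function.comp, ContinuousLinearMap.map_smul_of_tower, map_sub, hQ t ht]

/-- A strongly continuous semigroup can be modified at negative times so as to become strongly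
continuous on the whole line. -/
theorem GeneratesC0Semigroup.exists_continuous {G : E →ₗ.[ℂ] E} (h : GeneratesC0Semigroup G) :
    ∃ T : ℝ → E →L[ℂ] E, IsC0Semigroup T ∧ (∀ x, Continuous fun t => T t x) ∧
      ∀ x y, (x, y) ∈ G.graph ↔ InfGen T x y := by
  obtain ⟨T, hT, hG⟩ := h
  have hc : ∀ x, Continuous fun t : ℝ => T (max t 0) x := fun x =>
    (hT.strong_continuous x).comp_continuous (f := fun t : ℝ => max t 0) (by fun_prop)
      fun t => le_max_right t 0
  refine ⟨fun t => T (max t 0), ⟨fun x => (hc x).continuousOn, ?_, ?_⟩, hc, ?_⟩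
  · intro t s ht hs
    simp only [max_eq_left ht, max_eq_left hs, max_eq_left (add_nonneg ht hs)]
    exact hT.map_add t s ht hs
  · simpa using hT.map_zero
  · intro x y
    rw [hG x y]
    refine tendsto_congr' ?_
    filter_upwards [self_mem_nhdsWithin] with t ht
    rw [max_eq_left (le_of_lt ht)]

theorem exists_norm_le_of_strongly_continuous [CompleteSpace E] {T : ℝ → E →L[ℂ] E'}
    (hc : ∀ x, Continuous fun t => T t x) (a b : ℝ) :
    ∃ M : ℝ, 0 < M ∧ ∀ t ∈ Set.Icc a b, ‖T t‖ ≤ M := by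
  obtain ⟨C, hC⟩ := banach_steinhaus (g := fun t : Set.Icc a b => T t) (fun x => by
    obtain ⟨C, hC⟩ := isCompact_Icc.exists_bound_of_continuousOn (hc x).continuousOn
    exact ⟨C, fun t => hC t t.2⟩)
  exact ⟨max C 1, by positivity, fun t ht => (hC ⟨t, ht⟩).trans (le_max_left _ _)⟩

theorem continuous_uncurry_of_strongly_continuous [CompleteSpace E] {T : ℝ → E →L[ℂ] E'}
    (hc : ∀ x, Continuous fun t => T t x) : Continuous fun p : ℝ × E => T p.1 p.2 := by
  refine continuous_iff_continuousAt.2 fun ⟨t₀, x₀⟩ => ?_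
  obtain ⟨M, hM, hMT⟩ := exists_norm_le_of_strongly_continuous hc (t₀ - 1) (t₀ + 1)
  have h1 : Tendsto (fun p : ℝ × E => T p.1 (p.2 - x₀)) (𝓝 (t₀, x₀)) (𝓝 0) := by
    have h2 : Tendsto (fun p : ℝ × E => M * ‖p.2 - x₀‖) (𝓝 (t₀, x₀)) (𝓝 0) := by
      have : Continuous fun p : ℝ × E => M * ‖p.2 - x₀‖ := by fun_prop
      simpa using this.tendsto (t₀, x₀)
    refine squeeze_zero_norm' ?_ h2
    have h3 : ∀ᶠ p : ℝ × E in 𝓝 (t₀, x₀), p.1 ∈ Set.Icc (t₀ - 1) (t₀ + 1) :=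
      continuous_fst.continuousAt.eventually (Icc_mem_nhds (by simp) (by simp))
    filter_upwards [h3] with p hp
    exact (T p.1).le_of_opNorm_le (hMT _ hp) _
  have h4 : Tendsto (fun p : ℝ × E => T p.1 x₀) (𝓝 (t₀, x₀)) (𝓝 (T t₀ x₀)) :=
    ((hc x₀).comp continuous_fst).tendsto (t₀, x₀)
  have h5 := h1.add h4
  rw [zero_add] at h5
  refine h5.congr fun p => ?_
  simp

/-- Averages of a jointly continuous function over small intervals. -/
theorem tendsto_inv_smul_integral [CompleteSpace E] {f : ℝ → ℝ → E} (hf : Continuous (Function.uncurry f)) :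
    Tendsto (fun t : ℝ => t⁻¹ • ∫ s in (0 : ℝ)..t, f t s) (𝓝[>] 0) (𝓝 (f 0 0)) := by
  -- The substitution `s = t r` turns the average into an integral over `[0, 1]` that is continuous
  -- in `t` even at `t = 0`.
  have h1 : Continuous fun t : ℝ => ∫ r in (0 : ℝ)..1, f t (t * r) := by
    refine intervalIntegral.continuous_parametric_intervalIntegral_of_continuous' ?_ 0 1
    exact hf.comp (f := fun p : ℝ × ℝ => (p.1, p.1 * p.2)) (by fun_prop)
  have h2 := (h1.tendsto 0).mono_left (nhdsWithin_le_nhds (s := Set.Ioi 0))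
  simp only [zero_mul, intervalIntegral.integral_const, sub_zero, one_smul] at h2
  refine h2.congr' ?_
  filter_upwards [self_mem_nhdsWithin] with t ht
  rw [intervalIntegral.integral_comp_mul_left (f t) (ne_of_gt ht)]
  simp

/-- Exponential rescaling shifts the generator by `c`; this lets a semigroup be assumed to decay as
fast as desired. -/
theorem infGen_smul_exp (T : ℝ → E →L[ℂ] E) (c : ℝ) (x y : E) :
    InfGen (fun t => Real.exp (c * t) • T t) x y ↔ InfGen T x (y - c • x) := by
  have hd : Tendsto (fun t : ℝ => t⁻¹ * (Real.exp (c * t) - 1)) (𝓝[>] 0) (𝓝 c) := by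
    have h1 : HasDerivAt (fun t : ℝ => Real.exp (c * t)) c 0 := by
      simpa using ((hasDerivAt_id (0 : ℝ)).const_mul c).exp
    have h2 := (hasDerivAt_iff_tendsto_slope.1 h1).mono_left
      (nhdsWithin_mono 0 (fun t (ht : (0 : ℝ) < t) => ne_of_gt ht))
    refine h2.congr fun t => ?_
    simp [slope_def_field, div_eq_inv_mul]
  have he : Tendsto (fun t : ℝ => Real.exp (c * t)) (𝓝[>] 0) (𝓝 1) := by
    have : Continuous fun t : ℝ => Real.exp (c * t) := by fun_prop
    simpa using (this.tendsto 0).mono_left nhdsWithin_le_nhds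
  have he' : Tendsto (fun t : ℝ => Real.exp (-(c * t))) (𝓝[>] 0) (𝓝 1) := by
    have : Continuous fun t : ℝ => Real.exp (-(c * t)) := by fun_prop
    simpa using (this.tendsto 0).mono_left nhdsWithin_le_nhds
  constructor
  · intro h
    have h1 := he'.smul (Tendsto.sub h (hd.smul_const x))
    rw [one_smul] at h1
    refine h1.congr fun t => ?_
    simp only [smul_apply]
    rw [mul_smul, ← smul_sub, smul_comm, sub_smul, one_smul, sub_sub_sub_cancel_right,
      ← smul_sub, smul_smul (Real.exp _), ← Real.exp_add]
    simp
  · intro h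
    have h1 := (he.smul h).add (hd.smul_const x)
    rw [one_smul, sub_add_cancel] at h1
    refine h1.congr fun t => ?_
    simp only [smul_apply]
    rw [mul_smul, smul_comm, ← smul_add, smul_sub, sub_smul, one_smul]
    congr 1
    abel

theorem IsC0Semigroup.smul_exp {T : ℝ → E →L[ℂ] E} (hT : IsC0Semigroup T) (c : ℝ) :
    IsC0Semigroup (fun t => Real.exp (c * t) • T t) where
  strong_continuous x := by
    have : Continuous fun t : ℝ => Real.exp (c * t) := by fun_prop
    exact this.continuousOn.smul (hT.strong_continuous x)
  map_add t s ht hs := by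
    ext x
    simp only [hT.map_add t s ht hs, smul_apply, mul_apply_eq_comp,
      ContinuousLinearMap.map_smul_of_tower, smul_smul, mul_add, Real.exp_add]
  map_zero := by simp [hT.map_zero]

section Continuous

variable {T : ℝ → E →L[ℂ] E} (hT : IsC0Semigroup T)
  (hc : ∀ x, Continuous fun t => T t x)

include hT

theorem IsC0Semigroup.apply_add {t s : ℝ} (ht : 0 ≤ t) (hs : 0 ≤ s) (x : E) :
    T (t + s) x = T t (T s x) := by
  rw [hT.map_add t s ht hs, mul_apply_eq_comp]

theorem IsC0Semigroup.apply_comm {t s : ℝ} (ht : 0 ≤ t) (hs : 0 ≤ s) (x : E) :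
    T t (T s x) = T s (T t x) := by
  rw [← hT.apply_add ht hs, add_comm, hT.apply_add hs ht]

theorem IsC0Semigroup.infGen_apply {x y : E} (h : InfGen T x y) {t : ℝ} (ht : 0 ≤ t) :
    InfGen T (T t x) (T t y) :=
  h.map (T t) fun _ hs => hT.apply_comm ht hs.le x

variable [CompleteSpace E]

include hc

/-- Right product rule for `T s (u s)`. -/
theorem IsC0Semigroup.hasDerivWithinAt_apply {u : ℝ → E} {u' g : E} {s : ℝ} (hs : 0 ≤ s)
    (hu : HasDerivWithinAt u u' (Set.Ici s) s) (hg : InfGen T (u s) g) :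
    HasDerivWithinAt (fun r => T r (u r)) (T s u' + T s g) (Set.Ici s) s := by
  rw [← hasDerivWithinAt_Ioi_iff_Ici] at hu ⊢
  rw [hasDerivWithinAt_iff_tendsto_slope' (by simp)] at hu ⊢
  -- Split `T r (u r) - T s (u s)` as `T r (u r - u s) + T s (T (r - s) (u s) - u s)`; joint
  -- continuity handles the first term.
  have h1 : Tendsto (fun r => T r (slope u s r)) (𝓝[>] s) (𝓝 (T s u')) :=
    ((continuous_uncurry_of_strongly_continuous hc).tendsto (s, u')).comp
      ((tendsto_id.mono_left nhdsWithin_le_nhds).prodMk_nhds hu)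
  have hsub : Tendsto (fun r : ℝ => r - s) (𝓝[>] s) (𝓝[>] 0) := by
    refine tendsto_nhdsWithin_iff.2 ⟨?_, ?_⟩
    · have : Continuous fun r : ℝ => r - s := by fun_prop
      simpa using (this.tendsto s).mono_left nhdsWithin_le_nhds
    · filter_upwards [self_mem_nhdsWithin] with r hr
      exact sub_pos.2 (Set.mem_Ioi.1 hr)
  have h2 := ((T s).continuous.tendsto g).comp (Tendsto.comp hg hsub)
  refine (h1.add h2).congr' ?_
  filter_upwards [self_mem_nhdsWithin] with r hr
  have hr' : 0 ≤ r - s := (sub_pos.2 hr).le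
  have h3 : T s (T (r - s) (u s)) = T r (u s) := by
    rw [← hT.apply_add hs hr', add_sub_cancel]
  simp only [slope_def_module, Function.comp, ContinuousLinearMap.map_smul_of_tower, map_sub, h3]
  rw [← smul_add]
  congr 1
  abel

/-- By the product rule `s ↦ T s (u s)` has zero right derivative, hence is constant. This is the
uniqueness device behind both intertwining and time reversal. -/
theorem IsC0Semigroup.apply_eq_of_hasDerivWithinAt_neg {u g : ℝ → E} {t : ℝ} (ht : 0 ≤ t)
    (huc : ContinuousOn u (Set.Icc 0 t))
    (hu : ∀ s ∈ Set.Ico 0 t, HasDerivWithinAt u (-g s) (Set.Ici s) s)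
    (hg : ∀ s ∈ Set.Ico 0 t, InfGen T (u s) (g s)) : T t (u t) = u 0 := by
  have h := constant_of_has_deriv_right_zero (f := fun s => T s (u s)) (a := 0) (b := t)
    ((continuous_uncurry_of_strongly_continuous hc).comp_continuousOn
      (continuousOn_id.prodMk huc)) (fun s hs => by
      have := hT.hasDerivWithinAt_apply hc hs.1 (hu s hs) (hg s hs)
      rwa [map_neg, neg_add_cancel] at this) t ⟨ht, le_rfl⟩
  simpa [hT.map_zero] using h

theorem IsC0Semigroup.apply_sub_eq_integral {x y : E} (h : InfGen T x y) {t : ℝ} (ht : 0 ≤ t) :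
    T t x - x = ∫ s in (0 : ℝ)..t, T s y := by
  have hi : ∀ s, HasDerivAt (fun t : ℝ => ∫ s in (0 : ℝ)..t, T s y) (T s y) s := fun s =>
    intervalIntegral.integral_hasDerivAt_right ((hc y).intervalIntegrable _ _)
      ((hc y).stronglyMeasurableAtFilter _ _) (hc y).continuousAt
  have h1 := constant_of_has_deriv_right_zero
    (f := fun t => T t x - ∫ s in (0 : ℝ)..t, T s y) (a := 0) (b := t)
    ((hc x).sub (continuous_iff_continuousAt.2 fun s => (hi s).continuousAt)).continuousOn
    (fun s hs => by
      have h2 := (hT.hasDerivWithinAt_apply hc (u := fun _ => x) hs.1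
        (hasDerivWithinAt_const s _ x) h).fun_sub (hi s).hasDerivWithinAt
      simpa using h2) t ⟨ht, le_rfl⟩
  simp only [hT.map_zero, intervalIntegral.integral_same, sub_zero,
    one_apply_eq_self] at h1
  rw [sub_eq_iff_eq_add] at h1 ⊢
  exact h1.trans (add_comm _ _)

/-- The integral formula upgrades the right derivative to a two-sided one, as is needed to
differentiate `T (t - s) x` in `s`. -/
theorem IsC0Semigroup.hasDerivAt {x y : E} (h : InfGen T x y) {t : ℝ} (ht : 0 < t) :
    HasDerivAt (fun t => T t x) (T t y) t := by
  have hi : HasDerivAt (fun t : ℝ => x + ∫ s in (0 : ℝ)..t, T s y) (T t y) t :=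
    (intervalIntegral.integral_hasDerivAt_right ((hc y).intervalIntegrable _ _)
      ((hc y).stronglyMeasurableAtFilter _ _) (hc y).continuousAt).const_add x
  refine hi.congr_of_eventuallyEq ?_
  filter_upwards [lt_mem_nhds ht] with s hs
  rw [← hT.apply_sub_eq_integral hc h hs.le]
  abel

/-- `T h` shifts the interval of integration to `[h, t + h]`, so the difference quotient only sees
the two end pieces. -/
theorem IsC0Semigroup.infGen_integral (x : E) {t : ℝ} (ht : 0 ≤ t) :
    InfGen T (∫ s in (0 : ℝ)..t, T s x) (T t x - x) := by
  have hd : ∀ a, HasDerivAt (fun h : ℝ => ∫ s in (0 : ℝ)..h, T s x) (T a x) a := fun a =>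
    intervalIntegral.integral_hasDerivAt_right ((hc x).intervalIntegrable _ _)
      ((hc x).stronglyMeasurableAtFilter _ _) (hc x).continuousAt
  have h1 : HasDerivAt
      (fun h : ℝ => (∫ s in (0 : ℝ)..(t + h), T s x) - ∫ s in (0 : ℝ)..h, T s x)
      (T t x - x) 0 := by
    have h2 : HasDerivAt (fun h : ℝ => ∫ s in (0 : ℝ)..(t + h), T s x) (T t x) 0 := by
      have h3 := hd (t + 0)
      simpa using h3.comp_const_add t 0
    have h4 := h2.fun_sub (hd 0)
    simpa [hT.map_zero] using h4
  have h5 := (hasDerivAt_iff_tendsto_slope.1 h1).mono_left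
      (nhdsWithin_mono 0 (fun t (ht : (0 : ℝ) < t) => ne_of_gt ht))
  refine h5.congr' ?_
  filter_upwards [self_mem_nhdsWithin] with h hh
  have hh' : (0 : ℝ) ≤ h := (Set.mem_Ioi.1 hh).le
  have hint : ∀ a b, IntervalIntegrable (fun s => T s x) MeasureTheory.volume a b := fun a b =>
    (hc x).intervalIntegrable a b
  have h6 : T h (∫ s in (0 : ℝ)..t, T s x) = ∫ s in h..(t + h), T s x := by
    rw [← ContinuousLinearMap.intervalIntegral_comp_comm _ (hint 0 t)]
    have h7 := intervalIntegral.integral_comp_add_right (a := 0) (b := t) (fun s => T s x) h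
    rw [zero_add] at h7
    rw [← h7]
    refine intervalIntegral.integral_congr fun s hs => ?_
    rw [Set.uIcc_of_le ht] at hs
    rw [add_comm, hT.apply_add hh' hs.1]
  rw [slope_def_module, h6, ← intervalIntegral.integral_interval_sub_left (hint 0 (t + h)) (hint 0 h)]
  simp only [add_zero, intervalIntegral.integral_same, sub_zero]

theorem IsC0Semigroup.dense_infGen : Dense {x | ∃ y, InfGen T x y} := by
  intro x
  have h := tendsto_inv_smul_integral (f := fun _ s => T s x) ((hc x).comp continuous_snd)
  simp only [hT.map_zero, one_apply_eq_self] at h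
  refine mem_closure_of_tendsto h ?_
  filter_upwards [self_mem_nhdsWithin] with t ht
  exact ⟨_, (hT.infGen_integral hc x (Set.mem_Ioi.1 ht).le).smul t⁻¹⟩

/-- A bounded operator that intertwines the generators intertwines the semigroups. -/
theorem IsC0Semigroup.intertwine [CompleteSpace E'] {T' : ℝ → E' →L[ℂ] E'}
    (hT' : IsC0Semigroup T') (hc' : ∀ x, Continuous fun t => T' t x) (Q : E →L[ℂ] E')
    (hQ : ∀ x y, InfGen T x y → InfGen T' (Q x) (Q y)) {t : ℝ} (ht : 0 ≤ t) (x : E) :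
    Q (T t x) = T' t (Q x) := by
  have h1 : ∀ x ∈ {x | ∃ y, InfGen T x y}, Q (T t x) = T' t (Q x) := by
    rintro x ⟨y, hxy⟩
    -- `s ↦ T' s (Q (T (t - s) x))` is constant; compare its values at `0` and `t`.
    have := hT'.apply_eq_of_hasDerivWithinAt_neg hc' (u := fun s => Q (T (t - s) x))
      (g := fun s => Q (T (t - s) y)) ht
      (Q.continuous.comp ((hc x).comp (by fun_prop))).continuousOn
      (fun s hs => by
        have h2 := hT.hasDerivAt hc hxy (sub_pos.2 hs.2)
        have h3 := h2.comp_const_sub t s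
        have h4 := ((Q.restrictScalars ℝ).hasFDerivAt.comp_hasDerivAt s h3).hasDerivWithinAt
          (s := Set.Ici s)
        simpa [Function.comp_def] using h4)
      (fun s hs => hQ _ _ (hT.infGen_apply hxy (sub_pos.2 hs.2).le))
    simpa [hT.map_zero] using this.symm
  refine congrFun (Continuous.ext_on (hT.dense_infGen hc) (f := fun x => Q (T t x))
    (g := fun x => T' t (Q x)) (by fun_prop) (by fun_prop) h1) x

/-- The semigroup generated by an operator similar to its negative is invertible. -/
theorem IsC0Semigroup.apply_apply_of_neg (J : E →L[ℂ] E)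
    (hJG : ∀ x y, InfGen T x y → InfGen T (J x) (-J y)) {t : ℝ} (ht : 0 ≤ t) (x : E) :
    T t (J (T t x)) = J x := by
  have h1 : ∀ x ∈ {x | ∃ y, InfGen T x y}, T t (J (T t x)) = J x := by
    rintro x ⟨y, hxy⟩
    -- In the derivative of `T s (J (T s x))` the two terms cancel because `J` anticommutes with the
    -- generator.
    have := hT.apply_eq_of_hasDerivWithinAt_neg hc (u := fun s => J (T s x))
      (g := fun s => -J (T s y)) ht (J.continuous.comp (hc x)).continuousOn
      (fun s hs => by
        have h2 := hT.hasDerivWithinAt_apply hc (u := fun _ => x) hs.1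
          (hasDerivWithinAt_const s _ x) hxy
        have h3 := (J.restrictScalars ℝ).hasFDerivAt.comp_hasDerivWithinAt s h2
        simpa [Function.comp_def] using h3)
      (fun s hs => hJG _ _ (hT.infGen_apply hxy hs.1))
    simpa [hT.map_zero] using this
  refine congrFun (Continuous.ext_on (hT.dense_infGen hc) (f := fun x => T t (J (T t x)))
    (g := fun x => J x) (by fun_prop) (by fun_prop) h1) x

/-- A bound `M ≥ 1` on `[0, 1]`, iterated `⌊t⌋` times, gives `M * M ^ ⌊t⌋ ≤ M * exp (t log M)`. -/
theorem IsC0Semigroup.exists_norm_le_exp :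
    ∃ M ω : ℝ, 0 < M ∧ 0 ≤ ω ∧ ∀ t, 0 ≤ t → ‖T t‖ ≤ M * Real.exp (ω * t) := by
  obtain ⟨C, hC0, hC⟩ := exists_norm_le_of_strongly_continuous hc 0 1
  set M := max C 1 with hM
  have hM1 : 1 ≤ M := le_max_right _ _
  have hM0 : 0 < M := by positivity
  refine ⟨M, Real.log M, hM0, Real.log_nonneg hM1, fun t ht => ?_⟩
  have hn : ∀ n : ℕ, ∀ r ∈ Set.Icc (0 : ℝ) 1, ‖T (n + r)‖ ≤ M * M ^ n := by
    intro n
    induction n with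
    | zero =>
      intro r hr
      rw [Nat.cast_zero, zero_add, pow_zero, mul_one]
      exact (hC r hr).trans (le_max_left C 1)
    | succ n ih =>
      intro r hr
      have : ((n + 1 : ℕ) : ℝ) + r = 1 + (n + r) := by push_cast; ring
      rw [this, hT.map_add 1 (n + r) zero_le_one (by have := hr.1; positivity)]
      refine (norm_mul_le _ _).trans ?_
      calc ‖T 1‖ * ‖T (n + r)‖ ≤ M * (M * M ^ n) :=
            mul_le_mul ((hC 1 ⟨zero_le_one, le_rfl⟩).trans (le_max_left _ _)) (ih r hr)
              (norm_nonneg _) hM0.le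
        _ = M * M ^ (n + 1) := by ring
  have h1 := hn ⌊t⌋₊ (t - ⌊t⌋₊) ⟨sub_nonneg.2 (Nat.floor_le ht), by
    have := Nat.lt_floor_add_one t; linarith⟩
  rw [add_sub_cancel] at h1
  refine h1.trans (mul_le_mul_of_nonneg_left ?_ hM0.le)
  rw [← Real.rpow_def_of_pos hM0, ← Real.rpow_natCast]
  exact Real.rpow_le_rpow_of_exponent_le hM1 (Nat.floor_le ht)

end Continuous

end Semigroup

/-! ### Resolvents and bounded perturbations of semigroup generators. -/

section Perturbation

variable {E : Type*} [NormedAddCommGroup E] [NormedSpace ℂ E] [CompleteSpace E]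
  {T : ℝ → E →L[ℂ] E}

theorem exists_inverse_one_sub {F : Type*} [NormedAddCommGroup F] [NormedSpace ℂ F]
    [CompleteSpace F] (W : F →L[ℂ] F) (hW : ‖W‖ < 1) :
    ∃ N : F →L[ℂ] F, (∀ x, N x - W (N x) = x) ∧ ∀ x, N (x - W x) = x := by
  obtain ⟨N, hN1, hN2⟩ := isUnit_iff_exists.1 (isUnit_one_sub_of_norm_lt_one hW)
  refine ⟨N, fun x => ?_, fun x => ?_⟩
  · simpa using congrArg (fun f : F →L[ℂ] F => f x) hN1
  · simpa using congrArg (fun f : F →L[ℂ] F => f x) hN2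

theorem exists_integral_clm (hc : ∀ x, Continuous fun t => T t x) (a b : ℝ) :
    ∃ J : E →L[ℂ] E, ∀ x, J x = ∫ s in a..b, T s x := by
  obtain ⟨M, hM, hMT⟩ := exists_norm_le_of_strongly_continuous hc (min a b) (max a b)
  let J : E →ₗ[ℂ] E :=
    { toFun := fun x => ∫ s in a..b, T s x
      map_add' := fun x y => by
        simp only [map_add]
        exact intervalIntegral.integral_add ((hc x).intervalIntegrable _ _)
          ((hc y).intervalIntegrable _ _)
      map_smul' := fun c x => by
        simp only [map_smul, RingHom.id_apply]
        exact intervalIntegral.integral_smul c _ }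
  refine ⟨J.mkContinuous (M * |b - a|) fun x => ?_, fun x => rfl⟩
  rw [mul_right_comm]
  refine intervalIntegral.norm_integral_le_of_norm_le_const fun s hs => ?_
  exact (T s).le_of_opNorm_le (hMT s (Set.uIoc_subset_uIcc hs)) x

/-- Large real numbers belong to the resolvent set of the generator. -/
theorem IsC0Semigroup.exists_resolvent (hT : IsC0Semigroup T)
    (hc : ∀ x, Continuous fun t => T t x) :
    ∃ μ : ℝ, 0 < μ ∧ ∃ R : E →L[ℂ] E, (∀ y, InfGen T (R y) (μ • R y - y)) ∧
      ∀ x z, InfGen T x z → R (μ • x - z) = x := by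
  -- With `U t = exp (-μ t) T t` the operator `1 - U 1` is invertible, and the resolvent is `∫₀¹ U s
  -- ds` composed with its inverse. This replaces the improper Laplace integral.
  obtain ⟨μ, hμ, hμT⟩ : ∃ μ : ℝ, 0 < μ ∧ Real.exp (-μ) * ‖T 1‖ < 1 := by
    have h1 : Tendsto (fun μ : ℝ => Real.exp (-μ) * ‖T 1‖) atTop (𝓝 (0 * ‖T 1‖)) :=
      (Real.tendsto_exp_atBot.comp tendsto_neg_atTop_atBot).mul_const _
    rw [zero_mul] at h1
    exact ((eventually_gt_atTop 0).and (h1.eventually (gt_mem_nhds one_pos))).exists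
  set U : ℝ → E →L[ℂ] E := fun t => Real.exp (-μ * t) • T t with hU
  have hUs : IsC0Semigroup U := hT.smul_exp (-μ)
  have hUc : ∀ x, Continuous fun t => U t x := fun x => by
    have : Continuous fun t : ℝ => Real.exp (-μ * t) := by fun_prop
    exact this.smul (hc x)
  have hUG : ∀ x y, InfGen U x y ↔ InfGen T x (y + μ • x) := fun x y => by
    rw [hU, infGen_smul_exp, neg_smul, sub_neg_eq_add]
  obtain ⟨N, hN1, hN2⟩ := exists_inverse_one_sub (U 1) (by
    rw [hU]
    simp only [mul_one, norm_smul, Real.norm_eq_abs, Real.abs_exp]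
    exact hμT)
  obtain ⟨J, hJ⟩ := exists_integral_clm hUc 0 1
  have hJU : ∀ x, J (U 1 x) = U 1 (J x) := fun x => by
    rw [hJ, hJ, ← ContinuousLinearMap.intervalIntegral_comp_comm _
      ((hUc x).intervalIntegrable 0 1)]
    refine intervalIntegral.integral_congr fun s hs => ?_
    rw [Set.uIcc_of_le zero_le_one] at hs
    exact hUs.apply_comm hs.1 zero_le_one x
  have hJN : ∀ x, J (N x) = N (J x) := fun x => by
    rw [← hN2 (J (N x)), ← hJU, ← map_sub, hN1]
  refine ⟨μ, hμ, J.comp N, fun y => ?_, fun x z hxz => ?_⟩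
  · have h1 := hUs.infGen_integral hUc (N y) zero_le_one
    rw [← hJ, hUG] at h1
    have h2 : U 1 (N y) - N y + μ • J (N y) = μ • J (N y) - y := by
      rw [← neg_sub (N y), hN1]
      abel
    rwa [h2] at h1
  · have h1 : InfGen U x (z - μ • x) := by rwa [hUG, sub_add_cancel]
    have h2 := hUs.apply_sub_eq_integral hUc h1 zero_le_one
    rw [← hJ] at h2
    rw [ContinuousLinearMap.comp_apply, hJN, ← neg_sub z, map_neg J, ← h2, neg_sub, hN2]

open BoundedContinuousFunction in
/-- The Volterra equation of a bounded perturbation of an exponentially decaying family. -/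
theorem exists_volterra {U : ℝ → E →L[ℂ] E} (hc : ∀ x, Continuous fun t => U t x) {M r : ℝ}
    (hM : 0 < M) (hU : ∀ t, 0 ≤ t → ‖U t‖ ≤ M * Real.exp (-r * t)) (P : E →L[ℂ] E)
    (hP : M * ‖P‖ < r) :
    ∃ S : ℝ → E →L[ℂ] E, (∀ x, Continuous fun t => S t x) ∧ (∀ x, ∃ C, ∀ t, ‖S t x‖ ≤ C) ∧
      (∀ x t, 0 ≤ t → S t x = U t x + ∫ s in (0 : ℝ)..t, U (t - s) (P (S s x))) ∧
      ∀ (x : E) (v : ℝ → E), Continuous v → (∃ C, ∀ t, ‖v t‖ ≤ C) →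
        (∀ t, 0 ≤ t → v t = U t x + ∫ s in (0 : ℝ)..t, U (t - s) (P (v s))) →
        ∀ t, 0 ≤ t → v t = S t x := by
  have hr : 0 < r := lt_of_le_of_lt (by positivity) hP
  have hjc := continuous_uncurry_of_strongly_continuous hc
  -- Time is frozen at `0` on the negative axis, so that the equation lives in the Banach space `ℝ
  -- →ᵇ E`.
  have hcont : ∀ u : ℝ →ᵇ E, Continuous fun p : ℝ × ℝ => U (max p.1 0 - p.2) (P (u p.2)) :=
    fun u => hjc.comp (f := fun p : ℝ × ℝ => (max p.1 0 - p.2, P (u p.2))) (by fun_prop)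
  have hint : ∀ (u : ℝ →ᵇ E) (t a b : ℝ),
      IntervalIntegrable (fun s => U (max t 0 - s) (P (u s))) MeasureTheory.volume a b :=
    fun u t a b => ((hcont u).comp (f := fun s => (t, s)) (by fun_prop)).intervalIntegrable a b
  have hexp : ∀ τ : ℝ, 0 ≤ τ → ∫ s in (0 : ℝ)..τ, Real.exp (-r * (τ - s)) ≤ r⁻¹ := by
    intro τ hτ
    have h1 : ∀ s ∈ Set.uIcc 0 τ, HasDerivAt (fun s => r⁻¹ * Real.exp (-r * (τ - s)))
        (Real.exp (-r * (τ - s))) s := fun s _ => by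
      have h2 : HasDerivAt (fun s => -r * (τ - s)) r s := by
        simpa using ((hasDerivAt_id s).const_sub τ).const_mul (-r)
      refine (h2.exp.const_mul r⁻¹).congr_deriv ?_
      field_simp
    rw [intervalIntegral.integral_eq_sub_of_hasDerivAt h1
      ((by fun_prop : Continuous fun s => Real.exp (-r * (τ - s))).intervalIntegrable _ _)]
    simp only [sub_self, mul_zero, Real.exp_zero, mul_one]
    have : 0 ≤ r⁻¹ * Real.exp (-r * (τ - 0)) := by positivity
    linarith
  have hbound : ∀ (u : ℝ →ᵇ E) (t : ℝ),
      ‖∫ s in (0 : ℝ)..max t 0, U (max t 0 - s) (P (u s))‖ ≤ M * ‖P‖ * r⁻¹ * ‖u‖ := by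
    intro u t
    set τ := max t 0 with hτ
    have hτ0 : 0 ≤ τ := le_max_right _ _
    have h1 : ‖∫ s in (0 : ℝ)..τ, U (τ - s) (P (u s))‖ ≤
        ∫ s in (0 : ℝ)..τ, M * ‖P‖ * ‖u‖ * Real.exp (-r * (τ - s)) := by
      refine intervalIntegral.norm_integral_le_of_norm_le hτ0 (Eventually.of_forall fun s hs => ?_)
        ((by fun_prop : Continuous fun s => M * ‖P‖ * ‖u‖ * Real.exp (-r * (τ - s))
          ).intervalIntegrable _ _)
      calc ‖U (τ - s) (P (u s))‖ ≤ M * Real.exp (-r * (τ - s)) * (‖P‖ * ‖u‖) :=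
            (U (τ - s)).le_of_opNorm_le_of_le (hU _ (sub_nonneg.2 hs.2))
              (P.le_opNorm_of_le (u.norm_coe_le_norm s))
        _ = _ := by ring
    refine h1.trans ?_
    rw [intervalIntegral.integral_const_mul]
    calc _ ≤ M * ‖P‖ * ‖u‖ * r⁻¹ := mul_le_mul_of_nonneg_left (hexp τ hτ0) (by positivity)
      _ = _ := by ring
  let W₀ : (ℝ →ᵇ E) →ₗ[ℂ] (ℝ →ᵇ E) :=
    { toFun := fun u => ofNormedAddCommGroup
        (fun t => ∫ s in (0 : ℝ)..max t 0, U (max t 0 - s) (P (u s)))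
        (intervalIntegral.continuous_parametric_intervalIntegral_of_continuous (hcont u)
          (by fun_prop)) (M * ‖P‖ * r⁻¹ * ‖u‖) (hbound u)
      map_add' := fun u v => by
        ext t
        simp only [coe_ofNormedAddCommGroup, BoundedContinuousFunction.add_apply, map_add]
        exact intervalIntegral.integral_add (hint u _ _ _) (hint v _ _ _)
      map_smul' := fun c u => by
        ext t
        simp only [coe_ofNormedAddCommGroup, BoundedContinuousFunction.smul_apply, map_smul, RingHom.id_apply]
        exact intervalIntegral.integral_smul c _ }
  have hq : 0 ≤ M * ‖P‖ * r⁻¹ := by positivity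
  let W : (ℝ →ᵇ E) →L[ℂ] (ℝ →ᵇ E) := W₀.mkContinuous (M * ‖P‖ * r⁻¹) fun u =>
    norm_ofNormedAddCommGroup_le _ (by positivity) (hbound u)
  have hW : ∀ u t, W u t = ∫ s in (0 : ℝ)..max t 0, U (max t 0 - s) (P (u s)) := fun _ _ => rfl
  have hUM : ∀ t x, ‖U (max t 0) x‖ ≤ M * ‖x‖ := fun t x => by
    refine (U _).le_of_opNorm_le ((hU _ (le_max_right _ _)).trans ?_) x
    have : Real.exp (-r * max t 0) ≤ 1 := by
      rw [Real.exp_le_one_iff]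
      have := le_max_right t 0
      nlinarith
    nlinarith
  let O₀ : E →ₗ[ℂ] (ℝ →ᵇ E) :=
    { toFun := fun x => ofNormedAddCommGroup (fun t => U (max t 0) x)
        ((hc x).comp (by fun_prop)) (M * ‖x‖) fun t => hUM t x
      map_add' := fun x y => by ext t; simp
      map_smul' := fun c x => by ext t; simp }
  let O : E →L[ℂ] (ℝ →ᵇ E) := O₀.mkContinuous M fun x =>
    norm_ofNormedAddCommGroup_le _ (by positivity) fun t => hUM t x
  have hO : ∀ x t, O x t = U (max t 0) x := fun _ _ => rfl
  -- The Volterra operator has norm at most `M ‖P‖ / r < 1`, so `u - W u = O x` has a unique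
  -- solution depending boundedly on `x`.
  obtain ⟨N, hN1, hN2⟩ := exists_inverse_one_sub W
    ((W₀.mkContinuous_norm_le hq _).trans_lt (by
      rw [← div_eq_mul_inv, div_lt_one hr]
      exact hP))
  refine ⟨fun t => (evalCLM ℂ t).comp (N.comp O), fun x => (N (O x)).continuous,
    fun x => ⟨‖N (O x)‖, fun t => (N (O x)).norm_coe_le_norm t⟩, fun x t ht => ?_,
    fun x v hv hvb heq t ht => ?_⟩
  · have h1 := congrArg (fun u : ℝ →ᵇ E => u t) (hN1 (O x))
    simp only [BoundedContinuousFunction.sub_apply, hW, hO, max_eq_left ht] at h1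
    exact sub_eq_iff_eq_add.1 h1
  · obtain ⟨C, hC⟩ := hvb
    let w : ℝ →ᵇ E := ofNormedAddCommGroup (fun t => v (max t 0)) (hv.comp (by fun_prop)) C
      fun t => hC _
    have hw : w - W w = O x := by
      ext t
      rw [BoundedContinuousFunction.sub_apply, hW, hO]
      have h1 := heq (max t 0) (le_max_right _ _)
      have h2 : ∫ s in (0 : ℝ)..max t 0, U (max t 0 - s) (P (w s)) =
          ∫ s in (0 : ℝ)..max t 0, U (max t 0 - s) (P (v s)) := by
        refine intervalIntegral.integral_congr fun s hs => ?_
        rw [Set.uIcc_of_le (le_max_right _ _)] at hs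
        change U (max t 0 - s) (P (v (max s 0))) = _
        rw [max_eq_left hs.1]
      rw [h2]
      exact sub_eq_iff_eq_add.2 h1
    have h3 : N (O x) = w := by rw [← hw, hN2]
    change v t = N (O x) t
    rw [h3]
    change v t = v (max t 0)
    rw [max_eq_left ht]

/-- The bounded perturbation theorem for strongly continuous semigroups. -/
theorem IsC0Semigroup.exists_perturbation (hT : IsC0Semigroup T)
    (hc : ∀ x, Continuous fun t => T t x) (P : E →L[ℂ] E) :
    ∃ S : ℝ → E →L[ℂ] E, IsC0Semigroup S ∧
      ∀ x y, InfGen S x y ↔ InfGen T x (y - P x) := by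
  obtain ⟨M, ω, hM, hω, hMT⟩ := hT.exists_norm_le_exp hc
  -- After rescaling by `exp (-(ω + r) t)` the semigroup decays at rate `r`, as the contraction
  -- estimate requires.
  obtain ⟨r, hr⟩ : ∃ r : ℝ, M * ‖P‖ < r := exists_gt _
  set U : ℝ → E →L[ℂ] E := fun t => Real.exp (-(ω + r) * t) • T t with hU
  have hUs : IsC0Semigroup U := hT.smul_exp _
  have hUc : ∀ x, Continuous fun t => U t x := fun x => by
    have : Continuous fun t : ℝ => Real.exp (-(ω + r) * t) := by fun_prop
    exact this.smul (hc x)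
  have hUG : ∀ x y, InfGen U x y ↔ InfGen T x (y + (ω + r) • x) := fun x y => by
    rw [hU, infGen_smul_exp, neg_smul, sub_neg_eq_add]
  obtain ⟨S, hSc, hSb, hSv, hSu⟩ := exists_volterra hUc hM (r := r) (fun t ht => by
    rw [hU]
    simp only [norm_smul, Real.norm_eq_abs, Real.abs_exp]
    calc Real.exp (-(ω + r) * t) * ‖T t‖
        ≤ Real.exp (-(ω + r) * t) * (M * Real.exp (ω * t)) := by gcongr; exact hMT t ht
      _ = M * (Real.exp (-(ω + r) * t) * Real.exp (ω * t)) := by ring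
      _ = M * Real.exp (-r * t) := by rw [← Real.exp_add]; congr 2; ring) P hr
  have hjc := continuous_uncurry_of_strongly_continuous hUc
  have hI : ∀ (x : E) (t : ℝ), Continuous fun s => U (t - s) (P (S s x)) := fun x t =>
    hjc.comp (f := fun s => (t - s, P (S s x)))
      ((by fun_prop : Continuous fun s : ℝ => t - s).prodMk (P.continuous.comp (hSc x)))
  have hS0 : S 0 = 1 := by
    ext x
    simpa [hUs.map_zero] using hSv x 0 le_rfl
  have hSs : IsC0Semigroup S := by
    refine ⟨fun x => (hSc x).continuousOn, fun t s ht hs => ?_, hS0⟩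
    ext x
    -- The semigroup law is uniqueness for the Volterra equation: `t ↦ S (t + s) x` solves it with
    -- datum `S s x`.
    have h1 := hSu (S s x) (fun t => S (t + s) x) ((hSc x).comp (by fun_prop))
      ((hSb x).imp fun C hC t => hC _) (fun t ht => by
        rw [hSv x (t + s) (by positivity), hSv x s hs, _root_.map_add, ← hUs.apply_add ht hs,
          ← ContinuousLinearMap.intervalIntegral_comp_comm _ ((hI x s).intervalIntegrable 0 s),
          add_assoc, ← intervalIntegral.integral_add_adjacent_intervals (b := s)
            ((hI x (t + s)).intervalIntegrable 0 s) ((hI x (t + s)).intervalIntegrable s (t + s))]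
        congr 2
        · refine intervalIntegral.integral_congr fun a ha => ?_
          rw [Set.uIcc_of_le hs] at ha
          rw [← hUs.apply_add ht (sub_nonneg.2 ha.2), add_sub_assoc]
        · have h2 := intervalIntegral.integral_comp_add_right (a := 0) (b := t)
            (fun a => U (t + s - a) (P (S a x))) s
          rw [zero_add] at h2
          rw [← h2]
          refine intervalIntegral.integral_congr fun a _ => ?_
          simp only [add_sub_add_right_eq_sub]) t ht
    exact h1
  have hSG : ∀ x y, InfGen S x y ↔ InfGen U x (y - P x) := by
    intro x y
    -- The Volterra integral divided by `t` tends to `P x`, so the difference quotients of `S` and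
    -- `U` differ by `P x` in the limit.
    have h1 := tendsto_inv_smul_integral (f := fun t s => U (t - s) (P (S s x)))
      (hjc.comp (f := fun p : ℝ × ℝ => (p.1 - p.2, P (S p.2 x)))
        ((by fun_prop : Continuous fun p : ℝ × ℝ => p.1 - p.2).prodMk
          (P.continuous.comp ((hSc x).comp continuous_snd))))
    simp only [sub_self, hUs.map_zero, hS0, one_apply_eq_self] at h1
    have h2 : ∀ t : ℝ, 0 < t → t⁻¹ • (S t x - x) =
        t⁻¹ • (U t x - x) + t⁻¹ • ∫ s in (0 : ℝ)..t, U (t - s) (P (S s x)) := fun t ht => by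
      rw [hSv x t ht.le, ← smul_add]
      congr 1
      abel
    constructor
    · intro h
      refine (Tendsto.sub h h1).congr' ?_
      filter_upwards [self_mem_nhdsWithin] with t ht
      rw [h2 t ht, add_sub_cancel_right]
    · intro h
      have h3 := Tendsto.add h h1
      rw [sub_add_cancel] at h3
      refine h3.congr' ?_
      filter_upwards [self_mem_nhdsWithin] with t ht
      rw [h2 t ht]
  refine ⟨fun t => Real.exp ((ω + r) * t) • S t, hSs.smul_exp _, fun x y => ?_⟩
  rw [infGen_smul_exp, hSG, hUG]
  have : y - (ω + r) • x - P x + (ω + r) • x = y - P x := by abel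
  rw [this]

theorem GeneratesC0Semigroup.perturb {G G' : E →ₗ.[ℂ] E} (hG : GeneratesC0Semigroup G)
    (P : E →L[ℂ] E) (h : ∀ x y, (x, y) ∈ G'.graph ↔ (x, y - P x) ∈ G.graph) :
    GeneratesC0Semigroup G' := by
  obtain ⟨T, hT, hc, hTG⟩ := hG.exists_continuous
  obtain ⟨S, hS, hSG⟩ := hT.exists_perturbation hc P
  refine ⟨S, hS, fun x y => ?_⟩
  rw [h, hTG, ← hSG]
  rfl

end Perturbation

/-! ### Compression to a complemented invariant subspace. -/

section Transfer

variable {E : Type*} [NormedAddCommGroup E] [NormedSpace ℂ E] [CompleteSpace E]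
  {E' : Type*} [NormedAddCommGroup E'] [NormedSpace ℂ E']

/-- The part of a generator in a complemented invariant subspace. -/
theorem GeneratesC0Semigroup.retract {G : E →ₗ.[ℂ] E} {G' : E' →ₗ.[ℂ] E'}
    (hG : GeneratesC0Semigroup G) (J : E' →L[ℂ] E) (P : E →L[ℂ] E') (hPJ : ∀ x, P (J x) = x)
    (hJ : ∀ x y, (x, y) ∈ G'.graph → (J x, J y) ∈ G.graph)
    (hP : ∀ x y, (x, y) ∈ G.graph → (P x, P y) ∈ G'.graph) : GeneratesC0Semigroup G' := by
  obtain ⟨T, hT, hc, hTG⟩ := hG.exists_continuous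
  -- The projection `J P` preserves the graph of `G`, hence commutes with the semigroup.
  have hcomm : ∀ t, 0 ≤ t → ∀ x, J (P (T t x)) = T t (J (P x)) := fun t ht x =>
    hT.intertwine hc hT hc (J.comp P) (fun x y hxy => by
      rw [← hTG] at hxy ⊢
      exact hJ _ _ (hP _ _ hxy)) ht x
  refine ⟨fun t => P.comp ((T t).comp J), ⟨fun x => ?_, fun t s ht hs => ?_, ?_⟩, fun x y => ?_⟩
  · exact (P.continuous.comp (hc (J x))).continuousOn
  · ext x
    simp only [mul_apply_eq_comp, ContinuousLinearMap.comp_apply]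
    rw [hT.apply_add ht hs, hcomm s hs, hPJ]
  · ext x
    simp [hT.map_zero, hPJ]
  · change _ ↔ InfGen (fun t => P.comp ((T t).comp J)) x y
    constructor
    · intro h
      have h1 := ((hTG _ _).1 (hJ _ _ h)).map (T' := fun t => P.comp ((T t).comp J)) P
        (fun t ht => by
          simp only [ContinuousLinearMap.comp_apply]
          rw [hPJ])
      rwa [hPJ, hPJ] at h1
    · intro h
      have h1 := h.map (T' := T) J (fun t ht => by
        simp only [ContinuousLinearMap.comp_apply]
        rw [hcomm t ht.le, hPJ])
      have h2 := hP _ _ ((hTG _ _).2 h1)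
      rwa [hPJ, hPJ] at h2

end Transfer

/-! ### Cosine functions and phase spaces via the reduction matrix. -/

section Kisynski

variable {E : Type*} [NormedAddCommGroup E] [NormedSpace ℂ E] [CompleteSpace E]
  {F : Type*} [NormedAddCommGroup F] [NormedSpace ℂ F] [CompleteSpace F]
  {K : E →ₗ.[ℂ] E} {ι : F →L[ℂ] E}

theorem mem_graph_iff_exists {E F : Type*} [AddCommGroup E] [Module ℂ E] [AddCommGroup F]
    [Module ℂ F] {K : E →ₗ.[ℂ] F} {x : E} {y : F} :
    (x, y) ∈ K.graph ↔ ∃ h : x ∈ K.domain, K ⟨x, h⟩ = y := by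
  rw [LinearPMap.mem_graph_iff]
  constructor
  · rintro ⟨⟨u, hu⟩, rfl, h⟩
    exact ⟨hu, h⟩
  · rintro ⟨h, h'⟩
    exact ⟨⟨x, h⟩, rfl, h'⟩

omit [CompleteSpace E] [CompleteSpace F] in
theorem mem_reductionMatrix_graph (hι : Function.Injective ι) {f g : F} {e h : E} :
    ((f, e), (g, h)) ∈ (reductionMatrix K ι hι).graph ↔ ι g = e ∧ (ι f, h) ∈ K.graph := by
  rw [mem_graph_iff_exists, mem_graph_iff_exists]
  constructor
  · rintro ⟨⟨h1, h2⟩, h3⟩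
    obtain ⟨h4, h5⟩ := Prod.ext_iff.1 h3
    refine ⟨?_, h1, h5⟩
    have h6 := (LinearEquiv.symm_apply_eq _).1 h4
    exact (congrArg Subtype.val h6).symm
  · rintro ⟨rfl, h1, h2⟩
    refine ⟨⟨h1, g, rfl⟩, Prod.ext ?_ h2⟩
    exact (LinearEquiv.symm_apply_eq _).2 rfl

/-- A resolvent of `K`, factored through the Kisyński space. -/
theorem exists_resolvent_of_reductionMatrix {hι : Function.Injective ι}
    (hG : GeneratesC0Semigroup (reductionMatrix K ι hι)) :
    ∃ ω : ℝ, 0 < ω ∧ ∃ R : E →L[ℂ] F, (∀ y, (ι (R y), ω • ι (R y) - y) ∈ K.graph) ∧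
      ∀ f h, (ι f, h) ∈ K.graph → R (ω • ι f - h) = f := by
  obtain ⟨T, hT, hc, hTG⟩ := hG.exists_continuous
  obtain ⟨μ, hμ, R, hR1, hR2⟩ := hT.exists_resolvent hc
  -- Solving `(μ - matrix) (f, e) = (0, y)` forces `e = μ f` and `μ² f - K f = y`.
  refine ⟨μ * μ, mul_pos hμ hμ, (ContinuousLinearMap.fst ℂ F E).comp
    (R.comp (ContinuousLinearMap.inr ℂ F E)), fun y => ?_, fun f h hfh => ?_⟩
  · have h1 := (hTG _ _).2 (hR1 (0, y))
    have h2 := (mem_reductionMatrix_graph hι (f := (R (0, y)).1) (e := (R (0, y)).2)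
      (g := μ • (R (0, y)).1 - 0) (h := μ • (R (0, y)).2 - y)).1 h1
    obtain ⟨h3, h4⟩ := h2
    rw [sub_zero, ContinuousLinearMap.map_smul_of_tower] at h3
    rw [← h3, smul_smul] at h4
    exact h4
  · have h1 : ((f, μ • ι f), (μ • f, h)) ∈ (reductionMatrix K ι hι).graph :=
      (mem_reductionMatrix_graph hι).2 ⟨ContinuousLinearMap.map_smul_of_tower _ _ _, hfh⟩
    have h2 := hR2 _ _ ((hTG _ _).1 h1)
    have h3 : μ • (f, μ • ι f) - (μ • f, h) = (0, (μ * μ) • ι f - h) := by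
      ext <;> simp [smul_smul]
    rw [h3] at h2
    exact congrArg Prod.fst h2

/-- `K` is closed because it has a bounded resolvent: the limit `x` is recovered as `ι (R (ω x -
y))`. -/
theorem mem_graph_of_tendsto {hι : Function.Injective ι} (hle : K.domain ≤ LinearMap.range
    (ι : F →ₗ[ℂ] E)) (hG : GeneratesC0Semigroup (reductionMatrix K ι hι))
    {α : Type*} {l : Filter α} [l.NeBot] {u v : α → E} {x y : E} (hu : Tendsto u l (𝓝 x))
    (hv : Tendsto v l (𝓝 y)) (h : ∀ᶠ a in l, (u a, v a) ∈ K.graph) : (x, y) ∈ K.graph := by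
  obtain ⟨ω, hω, R, hR1, hR2⟩ := exists_resolvent_of_reductionMatrix hG
  have h1 : Tendsto (fun a => ι (R (ω • u a - v a))) l (𝓝 (ι (R (ω • x - y)))) :=
    ((ι.comp R).continuous.tendsto _).comp ((hu.const_smul ω).sub hv)
  have h2 : ι (R (ω • x - y)) = x := by
    refine tendsto_nhds_unique h1 (hu.congr' ?_)
    filter_upwards [h] with a ha
    obtain ⟨f, hf⟩ := hle (LinearPMap.mem_domain_of_mem_graph ha)
    change ι f = u a at hf
    rw [← hf] at ha ⊢
    rw [hR2 f _ ha]
  have h3 := hR1 (ω • x - y)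
  rwa [h2, sub_sub_cancel] at h3

omit [CompleteSpace F] in
-- Rescaling both integrals to `[0, 1]` gives `2 ∫₀¹ σ m(tσ) dσ`, with `m(s)` the mean of `c`
-- between `0` and `s`; at `t = 0` it equals `c 0`.
theorem tendsto_double_integral {c : ℝ → E} (hc : Continuous c) :
    Tendsto (fun t : ℝ => (2 / t ^ 2 : ℝ) • ∫ s in (0 : ℝ)..t, ∫ r in (0 : ℝ)..s, c r)
      (𝓝[>] 0) (𝓝 (c 0)) := by
  set m : ℝ → E := fun s => ∫ ρ in (0 : ℝ)..1, c (s * ρ) with hm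
  have hmc : Continuous m := by
    refine intervalIntegral.continuous_parametric_intervalIntegral_of_continuous' ?_ 0 1
    exact hc.comp (f := fun p : ℝ × ℝ => p.1 * p.2) (by fun_prop)
  have hm' : ∀ s, ∫ r in (0 : ℝ)..s, c r = s • m s := fun s => by
    rw [hm]
    simp only [intervalIntegral.smul_integral_comp_mul_left, mul_zero, mul_one]
  have hk : Continuous fun t : ℝ => ∫ σ in (0 : ℝ)..1, σ • m (t * σ) := by
    refine intervalIntegral.continuous_parametric_intervalIntegral_of_continuous' ?_ 0 1
    exact continuous_snd.smul (hmc.comp (f := fun p : ℝ × ℝ => p.1 * p.2) (by fun_prop))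
  have hk' : Continuous fun t : ℝ => (2 : ℝ) • ∫ σ in (0 : ℝ)..1, σ • m (t * σ) :=
    hk.const_smul 2
  have h1 := (hk'.tendsto 0).mono_left (nhdsWithin_le_nhds (s := Set.Ioi 0))
  have h2 : (2 : ℝ) • ∫ σ in (0 : ℝ)..1, σ • m (0 * σ) = c 0 := by
    simp only [zero_mul, intervalIntegral.integral_smul_const, hm, intervalIntegral.integral_const,
      smul_smul]
    norm_num
  rw [h2] at h1
  refine h1.congr' ?_
  filter_upwards [self_mem_nhdsWithin] with t ht
  have ht' : t ≠ 0 := ne_of_gt ht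
  have h3 : ∫ σ in (0 : ℝ)..1, σ • m (t * σ) =
      t⁻¹ • ∫ σ in (0 : ℝ)..1, (t * σ) • m (t * σ) := by
    rw [← intervalIntegral.integral_smul]
    refine intervalIntegral.integral_congr fun σ _ => ?_
    simp only [smul_smul]
    rw [inv_mul_cancel_left₀ ht']
  have h4 := intervalIntegral.integral_comp_mul_left (a := 0) (b := 1) (fun s => s • m s) ht'
  rw [h3, h4, smul_smul, smul_smul]
  simp only [hm', mul_zero, mul_one]
  congr 1
  field_simp

theorem tendsto_punctured_of_even {E : Type*} [TopologicalSpace E] {g : ℝ → E} (hg : ∀ t, g (-t) = g t) {y : E} :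
    Tendsto g (𝓝[≠] 0) (𝓝 y) ↔ Tendsto g (𝓝[>] 0) (𝓝 y) := by
  rw [← nhdsLT_sup_nhdsGT, tendsto_sup, and_iff_right_iff_imp]
  intro h
  have h1 : Tendsto (fun t : ℝ => -t) (𝓝[<] 0) (𝓝[>] 0) := by
    have := tendsto_neg_nhdsLT (a := (0 : ℝ))
    rwa [neg_zero] at this
  exact (h.comp h1).congr hg

/-- Reduces d'Alembert's equation for an even family to nonnegative arguments, up to swapping the
two terms on the left. -/
theorem abs_add_abs_cases (t s : ℝ) : |t| + |s| = |t + s| ∧ |(|t| - |s|)| = |t - s| ∨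
    |t| + |s| = |t - s| ∧ |(|t| - |s|)| = |t + s| := by
  rcases le_total 0 t with ht | ht <;> rcases le_total 0 s with hs | hs
  · left
    rw [abs_of_nonneg ht, abs_of_nonneg hs, abs_of_nonneg (add_nonneg ht hs)]
    simp
  · right
    rw [abs_of_nonneg ht, abs_of_nonpos hs, abs_of_nonneg (sub_nonneg.2 (hs.trans ht))]
    simp [sub_eq_add_neg]
  · right
    rw [abs_of_nonpos ht, abs_of_nonneg hs, abs_of_nonpos (sub_nonpos.2 (ht.trans hs)),
      ← abs_neg (t + s), neg_add']
    simp [sub_eq_add_neg, add_comm]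
  · left
    rw [abs_of_nonpos ht, abs_of_nonpos hs, abs_of_nonpos (add_nonpos ht hs), ← abs_neg (t - s),
      neg_sub']
    simp [add_comm]

/-- If the reduction matrix generates a semigroup, then `K` generates a cosine function. -/
theorem generatesCosine_of_reductionMatrix {hι : Function.Injective ι} (hle : K.domain ≤
    LinearMap.range (ι : F →ₗ[ℂ] E)) (hG : GeneratesC0Semigroup (reductionMatrix K ι hι)) :
    GeneratesCosine K := by
  obtain ⟨T, hT, hc, hTG⟩ := hG.exists_continuous
  have hTG' : ∀ (f g : F) (e h : E),
      InfGen T (f, e) (g, h) ↔ ι g = e ∧ (ι f, h) ∈ K.graph := fun f g e h =>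
    (hTG _ _).symm.trans (mem_reductionMatrix_graph hι)
  -- The off-diagonal matrix anticommutes with `J`, so `J` reverses time: `J T(t) J` is the inverse
  -- of `T(t)`.
  let J : F × E →L[ℂ] F × E :=
    (ContinuousLinearMap.id ℂ F).prodMap (-ContinuousLinearMap.id ℂ E)
  have hJ : ∀ f e, J (f, e) = (f, -e) := fun f e => rfl
  have hJJ : ∀ p, J (J p) = p := fun ⟨f, e⟩ => by rw [hJ, hJ, neg_neg]
  have hinv : ∀ t, 0 ≤ t → ∀ p, T t (J (T t (J p))) = p := fun t ht p => by
    rw [hT.apply_apply_of_neg hc J (fun x y hxy => ?_) ht, hJJ]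
    obtain ⟨h1, h2⟩ := (hTG' x.1 y.1 x.2 y.2).1 hxy
    have h3 : -J y = (-y.1, y.2) := by ext <;> simp [J]
    rw [h3]
    refine (hTG' x.1 (-y.1) (-x.2) y.2).2 ⟨by rw [map_neg, h1], h2⟩
  -- The cosine function is the lower right corner of the semigroup, extended evenly below.
  set C₀ : ℝ → E →L[ℂ] E := fun t => (ContinuousLinearMap.snd ℂ F E).comp
    ((T t).comp (ContinuousLinearMap.inr ℂ F E)) with hC₀
  have hC₀' : ∀ t x, C₀ t x = (T t (0, x)).2 := fun t x => rfl
  have hC₀c : ∀ x, Continuous fun t => C₀ t x := fun x => continuous_snd.comp (hc (0, x))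
  have hC₀0 : C₀ 0 = 1 := by
    ext x
    simp [hC₀', hT.map_zero]
  -- the second component of `T t T (-s) (0, x)`
  have hmix : ∀ t s, 0 ≤ t → 0 ≤ s → ∀ x, (T t (J (T s (J (0, x))))).2 = C₀ |t - s| x := by
    intro t s ht hs x
    rcases le_total s t with hst | hst
    · rw [abs_of_nonneg (sub_nonneg.2 hst), hC₀']
      have h1 := hT.apply_add (sub_nonneg.2 hst) hs (J (T s (J (0, x))))
      rw [sub_add_cancel, hinv s hs] at h1
      rw [h1]
    · rw [abs_of_nonpos (sub_nonpos.2 hst), neg_sub, hC₀']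
      have h1 := hT.apply_add ht (sub_nonneg.2 hst) (J (0, x))
      rw [add_sub_cancel] at h1
      have h2 := hinv t ht (J (T (s - t) (J (0, x))))
      rw [hJJ, ← h1] at h2
      rw [h2]
      have h3 : J (0, x) = -(0, x) := by ext <;> simp [J]
      rw [h3, map_neg]
      simp [J]
  have hdal₀ : ∀ t s, 0 ≤ t → 0 ≤ s → ∀ x,
      C₀ (t + s) x + C₀ |t - s| x = (2 : ℂ) • C₀ t (C₀ s x) := by
    intro t s ht hs x
    have h3 : J (0, x) = -(0, x) := by ext <;> simp [J]
    -- This is `T(s) + T(-s)` on `(0, x)`: the first components cancel. Applying `T t` yields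
    -- d'Alembert's equation.
    have h4 : T s (0, x) + J (T s (J (0, x))) = (2 : ℂ) • (0, C₀ s x) := by
      rw [h3, map_neg, hC₀']
      ext
      · simp [J]
      · simp [J, two_smul]
    rw [← hmix t s ht hs, hC₀', hT.apply_add ht hs, ← Prod.snd_add, ← map_add, h4, map_smul]
    rfl
  have hdal : ∀ t s : ℝ, ∀ x,
      C₀ |t + s| x + C₀ |t - s| x = (2 : ℂ) • C₀ |t| (C₀ |s| x) := by
    intro t s x
    have h1 := hdal₀ |t| |s| (abs_nonneg t) (abs_nonneg s) x
    rw [← h1]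
    have h2 := abs_add_abs_cases t s
    rcases h2 with ⟨h2, h3⟩ | ⟨h2, h3⟩
    · rw [h2, h3]
    · rw [h2, h3, add_comm]
  have hint : ∀ x t, 0 ≤ t →
      ((∫ s in (0 : ℝ)..t, ∫ r in (0 : ℝ)..s, C₀ r x), C₀ t x - x) ∈ K.graph := by
    intro x t ht
    have h1 : ∀ s, 0 ≤ s → ι (T s (0, x)).1 = ∫ r in (0 : ℝ)..s, C₀ r x ∧
        (ι (∫ r in (0 : ℝ)..s, T r (0, x)).1, C₀ s x - x) ∈ K.graph := fun s hs => by
      have h2 := hT.infGen_integral hc (0, x) hs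
      obtain ⟨h3, h4⟩ := (hTG' (∫ r in (0 : ℝ)..s, T r (0, x)).1 ((T s (0, x)).1 - 0)
        (∫ r in (0 : ℝ)..s, T r (0, x)).2 ((T s (0, x)).2 - x)).1 h2
      rw [sub_zero] at h3
      refine ⟨?_, h4⟩
      rw [h3]
      exact ((ContinuousLinearMap.snd ℂ F E).intervalIntegral_comp_comm
        ((hc (0, x)).intervalIntegrable 0 s)).symm
    have h5 : ι (∫ r in (0 : ℝ)..t, T r (0, x)).1 =
        ∫ s in (0 : ℝ)..t, ∫ r in (0 : ℝ)..s, C₀ r x := by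
      rw [← show ∫ s in (0 : ℝ)..t, ι (T s (0, x)).1 = ι (∫ r in (0 : ℝ)..t, T r (0, x)).1 from
        (ι.comp (ContinuousLinearMap.fst ℂ F E)).intervalIntegral_comp_comm
          ((hc (0, x)).intervalIntegrable 0 t)]
      refine intervalIntegral.integral_congr fun s hs => ?_
      rw [Set.uIcc_of_le ht] at hs
      exact (h1 s hs.1).1
    rw [← h5]
    exact (h1 t ht).2
  have htaylor : ∀ x y, (x, y) ∈ K.graph → ∀ t, 0 ≤ t →
      C₀ t x - x = ∫ s in (0 : ℝ)..t, ∫ r in (0 : ℝ)..s, C₀ r y := by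
    intro x y hxy t ht
    obtain ⟨f, hf⟩ := hle (LinearPMap.mem_domain_of_mem_graph hxy)
    change ι f = x at hf
    -- The generator sends `(0, x)` to `(f, 0)` and then to `(0, y)`; integrating twice gives the
    -- second-order Taylor formula.
    have h1 : InfGen T (0, x) (f, 0) := (hTG' _ _ _ _).2
      ⟨hf, by rw [map_zero]; exact K.graph.zero_mem⟩
    have h2 : InfGen T (f, 0) (0, y) := (hTG' _ _ _ _).2 ⟨map_zero _, by rwa [hf]⟩
    have h3 : ∀ s, 0 ≤ s → (T s (f, 0)).2 = ∫ r in (0 : ℝ)..s, C₀ r y := fun s hs => by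
      have h4 := congrArg Prod.snd (hT.apply_sub_eq_integral hc h2 hs)
      rw [Prod.snd_sub, sub_zero] at h4
      rw [h4]
      exact ((ContinuousLinearMap.snd ℂ F E).intervalIntegral_comp_comm
        ((hc (0, y)).intervalIntegrable 0 s)).symm
    have h5 := congrArg Prod.snd (hT.apply_sub_eq_integral hc h1 ht)
    refine h5.trans ?_
    rw [← show ∫ s in (0 : ℝ)..t, (T s (f, 0)).2 = (∫ s in (0 : ℝ)..t, T s (f, 0)).2 from
      (ContinuousLinearMap.snd ℂ F E).intervalIntegral_comp_comm
        ((hc (f, 0)).intervalIntegrable 0 t)]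
    refine intervalIntegral.integral_congr fun s hs => ?_
    rw [Set.uIcc_of_le ht] at hs
    exact h3 s hs.1
  refine ⟨fun t => C₀ |t|, ⟨fun x => (hC₀c x).comp continuous_abs, fun t s => ?_, ?_⟩,
    fun x y => ?_⟩
  · ext x
    simpa using hdal t s x
  · simp [hC₀0]
  · rw [tendsto_punctured_of_even (fun t => by simp only [abs_neg, neg_sq])]
    have hlim : ∀ z, Tendsto (fun t : ℝ => (2 / t ^ 2 : ℝ) •
        ∫ s in (0 : ℝ)..t, ∫ r in (0 : ℝ)..s, C₀ r z) (𝓝[>] 0) (𝓝 z) := fun z => by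
      have := tendsto_double_integral (hC₀c z)
      simpa only [hC₀0, one_apply_eq_self] using this
    constructor
    · intro hxy
      refine (hlim y).congr' ?_
      filter_upwards [self_mem_nhdsWithin] with t ht
      have ht' : 0 ≤ t := (Set.mem_Ioi.1 ht).le
      rw [abs_of_nonneg ht', htaylor x y hxy t ht']
    · intro h
      -- The rescaled double integrals of `C₀ r x` lie in `D(K)` and tend to `x`, and `K` maps them
      -- to the difference quotients; conclude by closedness.
      refine mem_graph_of_tendsto hle hG (hlim x) h ?_
      filter_upwards [self_mem_nhdsWithin] with t ht
      have ht' : 0 ≤ t := (Set.mem_Ioi.1 ht).le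
      rw [abs_of_nonneg ht']
      have h1 := K.graph.smul_mem ((2 / t ^ 2 : ℝ) : ℂ) (hint x t ht')
      exact h1

/-- The other requirements are automatic: both densities come from density of the generator's
domain, the norm bound from the resolvent being bounded `E → F`, and the cosine function from the
corner of the semigroup. -/
theorem generatesCosineWithPhaseSpace_iff :
    GeneratesCosineWithPhaseSpace K ι ↔ ∃ hι : Function.Injective ι,
      K.domain ≤ LinearMap.range (ι : F →ₗ[ℂ] E) ∧
        GeneratesC0Semigroup (reductionMatrix K ι hι) := by
  refine ⟨fun h => ⟨h.injective, h.domain_le, h.generates_semigroup⟩, ?_⟩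
  rintro ⟨hι, hle, hG⟩
  have hdense : Dense {p : F × E | ι p.1 ∈ K.domain ∧ p.2 ∈ Set.range ι} := by
    obtain ⟨T, hT, hc, hTG⟩ := hG.exists_continuous
    refine (hT.dense_infGen hc).mono ?_
    rintro ⟨f, e⟩ ⟨⟨g, h⟩, hfe⟩
    obtain ⟨h1, h2⟩ := (mem_reductionMatrix_graph hι).1 ((hTG _ _).2 hfe)
    exact ⟨LinearPMap.mem_domain_of_mem_graph h2, g, h1⟩
  refine ⟨generatesCosine_of_reductionMatrix hle hG, hι, ?_, hle, ?_, ?_, hG⟩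
  · refine (Prod.snd_surjective.denseRange.dense_image continuous_snd hdense).mono ?_
    rintro _ ⟨p, hp, rfl⟩
    exact hp.2
  · obtain ⟨ω, hω, R, hR1, hR2⟩ := exists_resolvent_of_reductionMatrix hG
    refine ⟨‖R‖ * (ω + 1), fun f hf => ?_⟩
    have h1 := hR2 f (K ⟨ι f, hf⟩) (LinearPMap.mem_graph K ⟨ι f, hf⟩)
    set y := K ⟨ι f, hf⟩
    calc ‖f‖ = ‖R (ω • ι f - y)‖ := by rw [h1]
      _ ≤ ‖R‖ * ‖ω • ι f - y‖ := R.le_opNorm _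
      _ ≤ ‖R‖ * (ω * ‖ι f‖ + ‖y‖) := by
        gcongr
        refine (norm_sub_le _ _).trans_eq ?_
        rw [norm_smul, Real.norm_of_nonneg hω.le]
      _ ≤ ‖R‖ * ((ω + 1) * (‖ι f‖ + ‖y‖)) := by
        gcongr
        nlinarith [norm_nonneg (ι f), norm_nonneg y]
      _ = _ := by ring
  · refine (Prod.fst_surjective.denseRange.dense_image continuous_fst hdense).mono ?_
    rintro _ ⟨p, hp, rfl⟩
    exact hp.1

theorem GeneratesCosineWithPhaseSpace.exists_resolvent (h : GeneratesCosineWithPhaseSpace K ι) :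
    ∃ ω : ℝ, 0 < ω ∧ ∃ R : E →L[ℂ] F, (∀ y, (ι (R y), ω • ι (R y) - y) ∈ K.graph) ∧
      ∀ f h, (ι f, h) ∈ K.graph → R (ω • ι f - h) = f :=
  exists_resolvent_of_reductionMatrix h.generates_semigroup

/-- In the reduction matrix `Q` enters as the bounded block `[[0, 0], [Q ι, 0]]` on `F × E`. -/
theorem GeneratesCosineWithPhaseSpace.perturb (h : GeneratesCosineWithPhaseSpace K ι)
    {K' : E →ₗ.[ℂ] E} (Q : E →L[ℂ] E)
    (hK : ∀ x y, (x, y) ∈ K'.graph ↔ (x, y - Q x) ∈ K.graph) :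
    GeneratesCosineWithPhaseSpace K' ι := by
  refine generatesCosineWithPhaseSpace_iff.2 ⟨h.injective, fun x hx => ?_, ?_⟩
  · obtain ⟨y, hy⟩ := LinearPMap.mem_domain_iff.1 hx
    exact h.domain_le (LinearPMap.mem_domain_of_mem_graph ((hK x y).1 hy))
  · refine h.generates_semigroup.perturb ((ContinuousLinearMap.inr ℂ F E).comp
      ((Q.comp ι).comp (ContinuousLinearMap.fst ℂ F E))) ?_
    rintro ⟨f, e⟩ ⟨g, y⟩
    rw [mem_reductionMatrix_graph, hK]
    have h1 : ((g, y) - ((ContinuousLinearMap.inr ℂ F E).comp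
      ((Q.comp ι).comp (ContinuousLinearMap.fst ℂ F E))) (f, e) : F × E) = (g, y - Q (ι f)) := by
      ext <;> simp
    rw [h1, mem_reductionMatrix_graph]

theorem GeneratesCosineWithPhaseSpace.perturb_iff {K' : E →ₗ.[ℂ] E} (Q : E →L[ℂ] E)
    (hK : ∀ x y, (x, y) ∈ K'.graph ↔ (x, y - Q x) ∈ K.graph) :
    GeneratesCosineWithPhaseSpace K ι ↔ GeneratesCosineWithPhaseSpace K' ι := by
  refine ⟨fun h => h.perturb Q hK, fun h => h.perturb (-Q) fun x y => ?_⟩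
  rw [hK]
  simp

section Similar

variable {E' : Type*} [NormedAddCommGroup E'] [NormedSpace ℂ E'] [CompleteSpace E']
  {F' : Type*} [NormedAddCommGroup F'] [NormedSpace ℂ F'] [CompleteSpace F']
  {K' : E' →ₗ.[ℂ] E'} {ι' : F' →L[ℂ] E'}

/-- The part of an operator generating a cosine function in a complemented invariant subspace. -/
theorem GeneratesCosineWithPhaseSpace.retract (h : GeneratesCosineWithPhaseSpace K ι)
    (J : E' →L[ℂ] E) (P : E →L[ℂ] E') (j : F' →L[ℂ] F) (p : F →L[ℂ] F')
    (hPJ : ∀ x, P (J x) = x) (hpj : ∀ x, p (j x) = x)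
    (hj : ∀ f, ι (j f) = J (ι' f)) (hp : ∀ f, ι' (p f) = P (ι f))
    (hJK : ∀ x y, (x, y) ∈ K'.graph → (J x, J y) ∈ K.graph)
    (hPK : ∀ x y, (x, y) ∈ K.graph → (P x, P y) ∈ K'.graph) :
    GeneratesCosineWithPhaseSpace K' ι' := by
  have hinj : Function.Injective ι' := fun f g hfg => by
    rw [← hpj f, ← hpj g, h.injective ((hj f).trans ((congrArg J hfg).trans (hj g).symm))]
  refine generatesCosineWithPhaseSpace_iff.2 ⟨hinj, fun x hx => ?_, ?_⟩
  · obtain ⟨y, hy⟩ := LinearPMap.mem_domain_iff.1 hx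
    obtain ⟨f, hf⟩ := h.domain_le (LinearPMap.mem_domain_of_mem_graph (hJK x y hy))
    refine ⟨p f, (hp f).trans ?_⟩
    change ι f = J x at hf
    rw [hf, hPJ]
  · refine h.generates_semigroup.retract (j.prodMap J) (p.prodMap P)
      (fun x => Prod.ext (hpj x.1) (hPJ x.2)) ?_ ?_
    · rintro ⟨f, e⟩ ⟨g, y⟩ hxy
      obtain ⟨h1, h2⟩ := (mem_reductionMatrix_graph _).1 hxy
      refine (mem_reductionMatrix_graph _).2 ⟨(hj g).trans (congrArg J h1), ?_⟩
      change (ι (j f), J y) ∈ _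
      rw [hj]
      exact hJK _ _ h2
    · rintro ⟨f, e⟩ ⟨g, y⟩ hxy
      obtain ⟨h1, h2⟩ := (mem_reductionMatrix_graph _).1 hxy
      refine (mem_reductionMatrix_graph _).2 ⟨(hp g).trans (congrArg P h1), ?_⟩
      change (ι' (p f), P y) ∈ _
      rw [hp]
      exact hPK _ _ h2

/-- Generation of a cosine function with a given phase space is invariant under similarity. -/
theorem GeneratesCosineWithPhaseSpace.similar_iff (Ψ : E ≃L[ℂ] E') (Φ : F ≃L[ℂ] F')
    (hΦ : ∀ f, ι' (Φ f) = Ψ (ι f))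
    (hK : ∀ x y, (x, y) ∈ K.graph ↔ (Ψ x, Ψ y) ∈ K'.graph) :
    GeneratesCosineWithPhaseSpace K ι ↔ GeneratesCosineWithPhaseSpace K' ι' := by
  have hΦ' : ∀ f, ι (Φ.symm f) = Ψ.symm (ι' f) := fun f => by
    rw [ContinuousLinearEquiv.eq_symm_apply, ← hΦ, Φ.apply_symm_apply]
  have hK' : ∀ x y, (x, y) ∈ K'.graph → (Ψ.symm x, Ψ.symm y) ∈ K.graph := fun x y hxy => by
    rw [hK, Ψ.apply_symm_apply, Ψ.apply_symm_apply]
    exact hxy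
  exact ⟨fun h => h.retract (Ψ.symm : E' →L[ℂ] E) (Ψ : E →L[ℂ] E') (Φ.symm : F' →L[ℂ] F)
      (Φ : F →L[ℂ] F') Ψ.apply_symm_apply Φ.apply_symm_apply hΦ' hΦ hK' fun x y => (hK x y).1,
    fun h => h.retract (Ψ : E →L[ℂ] E') (Ψ.symm : E' →L[ℂ] E) (Φ : F →L[ℂ] F')
      (Φ.symm : F' →L[ℂ] F) Ψ.symm_apply_apply Φ.symm_apply_apply hΦ hΦ'
      (fun x y => (hK x y).1) hK'⟩

end Similar

end Kisynski

/-! ### Triangular matrices with zero second column. -/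

section FirstColumn

variable {E : Type*} [NormedAddCommGroup E] [NormedSpace ℂ E]
  {F : Type*} [NormedAddCommGroup F] [NormedSpace ℂ F]
  {W : Type*} [NormedAddCommGroup W] [NormedSpace ℂ W]

/-- Extending a semigroup by the identity on a complementary subspace. -/
theorem IsC0Semigroup.exists_extend {T : ℝ → F →L[ℂ] F} (hT : IsC0Semigroup T)
    (hc : ∀ x, Continuous fun t => T t x) (J : F →L[ℂ] E) (P : E →L[ℂ] F)
    (hPJ : ∀ x, P (J x) = x) :
    ∃ S : ℝ → E →L[ℂ] E, IsC0Semigroup S ∧ (∀ x, Continuous fun t => S t x) ∧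
      ∀ x y, InfGen S x y ↔ InfGen T (P x) (P y) ∧ J (P y) = y := by
  -- All difference quotients lie in the range of `J`, whence the condition `J (P y) = y` in the
  -- generator.
  set S : ℝ → E →L[ℂ] E := fun t => 1 + J.comp ((T t - 1).comp P) with hS
  have hS' : ∀ t x, S t x = x + J (T t (P x) - P x) := fun t x => rfl
  have hSc : ∀ x, Continuous fun t => S t x := fun x =>
    continuous_const.add (J.continuous.comp ((hc (P x)).sub continuous_const))
  refine ⟨S, ⟨fun x => (hSc x).continuousOn, fun t s ht hs => ?_, ?_⟩, hSc, fun x y => ?_⟩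
  · ext x
    simp only [mul_apply_eq_comp, hS', _root_.map_add, map_sub, hPJ, hT.apply_add ht hs]
    abel
  · ext x
    simp [hS', hT.map_zero]
  · have hquot : ∀ t : ℝ, t⁻¹ • (S t x - x) = J (t⁻¹ • (T t (P x) - P x)) := fun t => by
      rw [hS', add_sub_cancel_left, ContinuousLinearMap.map_smul_of_tower]
    constructor
    · intro h
      have h1 : InfGen T (P x) (P y) := h.map P fun t _ => by
        rw [hS', _root_.map_add, hPJ, add_sub_cancel]
      refine ⟨h1, tendsto_nhds_unique (((J.continuous.tendsto _).comp h1).congr fun t => ?_) h⟩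
      rw [hquot]
      rfl
    · rintro ⟨h1, h2⟩
      have h3 := (J.continuous.tendsto _).comp h1
      rw [h2] at h3
      refine h3.congr fun t => ?_
      rw [hquot]
      rfl

/-- The operator matrix `[[H, 0], [B, 0]]` on `E × W` with domain `D(H) × W`. -/
def firstColumn (H : E →ₗ.[ℂ] E) (B : H.domain →ₗ[ℂ] W) : (E × W) →ₗ.[ℂ] (E × W) where
  domain := H.domain.comap (LinearMap.fst ℂ E W)
  toFun := (H.toFun.prod B) ∘ₗ (LinearMap.fst ℂ E W).restrict fun _ h => h

theorem mem_firstColumn_graph {H : E →ₗ.[ℂ] E} {B : H.domain →ₗ[ℂ] W} {x y : E} {a b : W} :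
    ((x, a), (y, b)) ∈ (firstColumn H B).graph ↔
      ∃ h : x ∈ H.domain, H ⟨x, h⟩ = y ∧ B ⟨x, h⟩ = b := by
  rw [mem_graph_iff_exists]
  exact exists_congr fun h => Prod.ext_iff

theorem mem_vadd_graph {K : E →ₗ.[ℂ] E} (Q : E →L[ℂ] E) {x y : E} :
    (x, y) ∈ ((Q : E →ₗ[ℂ] E) +ᵥ K).graph ↔ (x, y - Q x) ∈ K.graph := by
  rw [mem_graph_iff_exists, mem_graph_iff_exists]
  refine exists_congr fun h => ?_
  rw [LinearPMap.vadd_apply, eq_sub_iff_add_eq, add_comm]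
  rfl

variable [CompleteSpace E] [CompleteSpace F] [CompleteSpace W]

/-- The reduction matrix splits into that of `H` and the nilpotent block `[[0, 1], [0, 0]]` on `W ×
W`. The former is extended by a trivial semigroup, the latter (`N` below) added as a bounded
perturbation; the converse is compression to the first component. -/
theorem generatesCosineWithPhaseSpace_firstColumn_zero_iff {H : E →ₗ.[ℂ] E} {ι : F →L[ℂ] E} :
    GeneratesCosineWithPhaseSpace (firstColumn H (0 : H.domain →ₗ[ℂ] W))
      (ι.prodMap (ContinuousLinearMap.id ℂ W)) ↔ GeneratesCosineWithPhaseSpace H ι := by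
  constructor
  · intro h
    refine h.retract (ContinuousLinearMap.inl ℂ E W) (ContinuousLinearMap.fst ℂ E W)
      (ContinuousLinearMap.inl ℂ F W) (ContinuousLinearMap.fst ℂ F W) (fun _ => rfl)
      (fun _ => rfl) (fun _ => rfl) (fun _ => rfl) (fun x y hxy => ?_) ?_
    · obtain ⟨h1, h2⟩ := mem_graph_iff_exists.1 hxy
      exact mem_firstColumn_graph.2 ⟨h1, h2, rfl⟩
    · rintro ⟨x, a⟩ ⟨y, b⟩ hxy
      obtain ⟨h1, h2, -⟩ := mem_firstColumn_graph.1 hxy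
      exact mem_graph_iff_exists.2 ⟨h1, h2⟩
  · intro h
    have hinj : Function.Injective (ι.prodMap (ContinuousLinearMap.id ℂ W)) :=
      h.injective.prodMap Function.injective_id
    refine generatesCosineWithPhaseSpace_iff.2 ⟨hinj, ?_, ?_⟩
    · rintro ⟨x, a⟩ hx
      obtain ⟨f, hf⟩ := h.domain_le (x := x) hx
      exact ⟨(f, a), Prod.ext hf rfl⟩
    · obtain ⟨T, hT, hc, hTG⟩ := h.generates_semigroup.exists_continuous
      obtain ⟨S, hS, hSc, hSG⟩ := hT.exists_extend hc
        ((ContinuousLinearMap.inl ℂ F W).prodMap (ContinuousLinearMap.inl ℂ E W))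
        ((ContinuousLinearMap.fst ℂ F W).prodMap (ContinuousLinearMap.fst ℂ E W)) fun _ => rfl
      let N : (F × W) × (E × W) →L[ℂ] (F × W) × (E × W) :=
        (ContinuousLinearMap.inl ℂ (F × W) (E × W)).comp ((ContinuousLinearMap.inr ℂ F W).comp
          ((ContinuousLinearMap.snd ℂ E W).comp (ContinuousLinearMap.snd ℂ (F × W) (E × W))))
      obtain ⟨U, hU, hUG⟩ := hS.exists_perturbation hSc N
      refine ⟨U, hU, ?_⟩
      rintro ⟨⟨f, a⟩, ⟨e, b⟩⟩ ⟨⟨g, a'⟩, ⟨y, b'⟩⟩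
      have h1 : (((g, a'), (y, b')) - N ((f, a), (e, b)) : (F × W) × (E × W)) =
          ((g, a' - b), (y, b')) := by
        ext <;> simp [N]
      refine Iff.trans ?_ (hUG _ _).symm
      rw [h1, hSG, mem_reductionMatrix_graph, mem_firstColumn_graph]
      refine Iff.trans ?_ (and_congr_left' ((mem_reductionMatrix_graph h.injective).symm.trans
        (hTG (f, e) (g, y))))
      rw [mem_graph_iff_exists]
      constructor
      · rintro ⟨h2, h3, h4, h5⟩
        obtain ⟨h6, h7⟩ := Prod.ext_iff.1 h2
        change a' = b at h7
        change (0 : W) = b' at h5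
        refine ⟨⟨h6, h3, h4⟩, ?_⟩
        rw [h7, ← h5, sub_self]
        rfl
      · rintro ⟨⟨h6, h3, h4⟩, h2⟩
        have h7 : (0 : W) = a' - b := congrArg (fun p => p.1.2) h2
        have h5 : (0 : W) = b' := congrArg (fun p => p.2.2) h2
        exact ⟨Prod.ext h6 (sub_eq_zero.1 h7.symm), h3, h4, h5⟩

/-- With `Q = B R` for a resolvent `R` of `H` at `ω`, one has `Q H = ω Q - B` on `D(H)`. The shear
`(x, a) ↦ (x, a + Q x)` therefore turns the entry `B` into the bounded entry `ω Q`. -/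
theorem generatesCosineWithPhaseSpace_firstColumn_iff {H : E →ₗ.[ℂ] E} {B : H.domain →ₗ[ℂ] W}
    {ι : F →L[ℂ] E}
    (hB : ∀ (ω : ℝ) (R : E →L[ℂ] E), (∀ y, (R y, ω • R y - y) ∈ H.graph) →
      ∃ Q : E →L[ℂ] W, ∀ y (h : R y ∈ H.domain), Q y = B ⟨R y, h⟩) :
    GeneratesCosineWithPhaseSpace (firstColumn H B) (ι.prodMap (ContinuousLinearMap.id ℂ W)) ↔
      GeneratesCosineWithPhaseSpace H ι := by
  have key : ∀ (ω : ℝ) (R : E →L[ℂ] E), (∀ y, (R y, ω • R y - y) ∈ H.graph) →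
      (∀ x y, (x, y) ∈ H.graph → R (ω • x - y) = x) →
      (GeneratesCosineWithPhaseSpace (firstColumn H B)
        (ι.prodMap (ContinuousLinearMap.id ℂ W)) ↔ GeneratesCosineWithPhaseSpace H ι) := by
    intro ω R hR1 hR2
    obtain ⟨Q, hQ⟩ := hB ω R hR1
    have hQ' : ∀ x (h : x ∈ H.domain), Q (H ⟨x, h⟩) = ω • Q x - B ⟨x, h⟩ := fun x h => by
      have h1 := hR2 x (H ⟨x, h⟩) (LinearPMap.mem_graph H ⟨x, h⟩)
      have h2 := hQ (ω • x - H ⟨x, h⟩) (h1.symm ▸ h)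
      have h3 : B ⟨R (ω • x - H ⟨x, h⟩), h1.symm ▸ h⟩ = B ⟨x, h⟩ :=
        congrArg B (Subtype.ext h1)
      rw [h3, map_sub, ContinuousLinearMap.map_smul_of_tower] at h2
      rw [← h2, sub_sub_cancel]
    let N : E × W →L[ℂ] E × W := (ContinuousLinearMap.inr ℂ E W).comp
      ((ω • Q).comp (ContinuousLinearMap.fst ℂ E W))
    have hN : ∀ p, N p = (0, ω • Q p.1) := fun _ => rfl
    rw [← generatesCosineWithPhaseSpace_firstColumn_zero_iff (W := W) (H := H) (ι := ι),
      GeneratesCosineWithPhaseSpace.perturb_iff (K := firstColumn H (0 : H.domain →ₗ[ℂ] W)) N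
        fun x y => mem_vadd_graph N]
    refine GeneratesCosineWithPhaseSpace.similar_iff
      ((ContinuousLinearEquiv.refl ℂ E).skewProd (ContinuousLinearEquiv.refl ℂ W) Q)
      ((ContinuousLinearEquiv.refl ℂ F).skewProd (ContinuousLinearEquiv.refl ℂ W) (Q.comp ι))
      (fun _ => rfl) ?_
    rintro ⟨x, a⟩ ⟨y, b⟩
    rw [mem_vadd_graph]
    have h1 : ((ContinuousLinearEquiv.refl ℂ E).skewProd (ContinuousLinearEquiv.refl ℂ W) Q) (x, a)
        = (x, a + Q x) := rfl
    have h2 : ((ContinuousLinearEquiv.refl ℂ E).skewProd (ContinuousLinearEquiv.refl ℂ W) Q) (y, b)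
        - N (x, a + Q x) = (y, b + Q y - ω • Q x) := by
      rw [hN]
      exact Prod.ext (sub_zero y) rfl
    rw [h1, h2, mem_firstColumn_graph, mem_firstColumn_graph]
    refine exists_congr fun h => and_congr_right fun hy => ?_
    rw [← hy, hQ']
    constructor
    · rintro rfl
      simp
    · intro h3
      rw [LinearMap.zero_apply] at h3
      rw [← sub_eq_zero, ← neg_eq_zero, h3]
      abel
  constructor
  -- Here a resolvent of `H` must first be extracted, as the upper left corner of that of the
  -- matrix.
  · intro h
    obtain ⟨ω, hω, R, hR1, hR2⟩ := h.exists_resolvent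
    refine (key ω (ι.comp ((ContinuousLinearMap.fst ℂ F W).comp
      (R.comp (ContinuousLinearMap.inl ℂ E W)))) (fun y => ?_) fun x y hxy => ?_).1 h
    · obtain ⟨h1, h2, -⟩ := mem_firstColumn_graph.1 (hR1 (y, 0))
      exact mem_graph_iff_exists.2 ⟨h1, h2⟩
    · obtain ⟨h1, h2⟩ := mem_graph_iff_exists.1 hxy
      -- The second component is chosen so that `ω - firstColumn H B` maps the pair to `(ω x - y,
      -- 0)`.
      obtain ⟨⟨f, a⟩, hf⟩ := h.domain_le (x := (x, ω⁻¹ • B ⟨x, h1⟩)) h1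
      obtain ⟨hf1, hf2⟩ := Prod.ext_iff.1 hf
      change ι f = x at hf1
      change a = ω⁻¹ • B ⟨x, h1⟩ at hf2
      have h3 := hR2 (f, a) (y, B ⟨x, h1⟩) (by
        change ((ι f, a), _) ∈ _
        rw [hf1]
        exact mem_firstColumn_graph.2 ⟨h1, h2, rfl⟩)
      have h4 : (ω • (ι.prodMap (ContinuousLinearMap.id ℂ W)) (f, a) - (y, B ⟨x, h1⟩) : E × W) =
          (ω • x - y, 0) := by
        change (ω • ι f - y, ω • a - B ⟨x, h1⟩) = _
        rw [hf1, hf2, smul_inv_smul₀ hω.ne', sub_self]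
      rw [h4] at h3
      change ι (R (ω • x - y, 0)).1 = x
      rw [h3, hf1]
  · intro h
    obtain ⟨ω, hω, R, hR1, hR2⟩ := h.exists_resolvent
    refine (key ω (ι.comp R) hR1 fun x y hxy => ?_).2 h
    obtain ⟨f, hf⟩ := h.domain_le (LinearPMap.mem_domain_of_mem_graph hxy)
    change ι f = x at hf
    rw [← hf] at hxy ⊢
    exact congrArg ι (hR2 f y hxy)

end FirstColumn

/-! ### The Dirichlet operator and boundedness by closed graphs. -/

section Dirichlet

variable {X dX : Type*} [NormedAddCommGroup X] [NormedSpace ℂ X]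
  [NormedAddCommGroup dX] [NormedSpace ℂ dX]
  {A : X →ₗ.[ℂ] X} {L : A.domain →ₗ[ℂ] dX}

theorem mem_kerDomain {v : X} :
    v ∈ kerDomain A L ↔ ∃ h : v ∈ A.domain, L ⟨v, h⟩ = 0 := by
  constructor
  · rintro ⟨u, hu, rfl⟩
    exact ⟨u.2, hu⟩
  · rintro ⟨h, h'⟩
    exact ⟨⟨v, h⟩, h', rfl⟩

theorem mem_restrictKer_graph {v y : X} :
    (v, y) ∈ (restrictKer A L).graph ↔ ∃ h : v ∈ A.domain, L ⟨v, h⟩ = 0 ∧ A ⟨v, h⟩ = y := by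
  rw [mem_graph_iff_exists]
  constructor
  · rintro ⟨h, h'⟩
    obtain ⟨h1, h2⟩ := mem_kerDomain.1 h
    exact ⟨h1, h2, h'⟩
  · rintro ⟨h1, h2, h'⟩
    exact ⟨mem_kerDomain.2 ⟨h1, h2⟩, h'⟩

theorem mem_column_graph {v y : X} {x : dX} :
    (v, (y, x)) ∈ (column A L).graph ↔ ∃ h : v ∈ A.domain, A ⟨v, h⟩ = y ∧ L ⟨v, h⟩ = x := by
  rw [mem_graph_iff_exists]
  exact exists_congr fun h => Prod.ext_iff

variable (hL : Function.Surjective L) {μ : ℂ} (hμ : μ ∈ resolventSet (restrictKer A L))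

theorem boundary_dirichlet (x : dX) : L (dirichlet A L hL hμ x) = x :=
  (LinearEquiv.ofBijective (L ∘ₗ (eigenKer A μ).subtype)
    (bijective_restrict_eigenKer A L hL hμ)).apply_symm_apply x

theorem apply_dirichlet (x : dX) : A (dirichlet A L hL hμ x) = μ • (dirichlet A L hL hμ x : X) :=
  (sub_eq_zero.1 ((LinearEquiv.ofBijective (L ∘ₗ (eigenKer A μ).subtype)
    (bijective_restrict_eigenKer A L hL hμ)).symm x).2).symm

theorem mem_perturbed_graph {B : A.domain →ₗ[ℂ] dX} {v y : X} :
    (v, y) ∈ (perturbed A L hL B hμ).graph ↔ ∃ h : v ∈ A.domain, L ⟨v, h⟩ = 0 ∧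
      A ⟨v, h⟩ - dirichlet A L hL hμ (B ⟨v, h⟩) = y := by
  rw [mem_graph_iff_exists]
  constructor
  · rintro ⟨h, h'⟩
    obtain ⟨h1, h2⟩ := mem_kerDomain.1 h
    exact ⟨h1, h2, h'⟩
  · rintro ⟨h1, h2, h'⟩
    exact ⟨mem_kerDomain.2 ⟨h1, h2⟩, h'⟩

theorem mem_operatorMatrix_graph {B : A.domain →ₗ[ℂ] dX} {Bt : dX →L[ℂ] dX} {u w : X} {x z : dX} :
    ((u, x), (w, z)) ∈ (operatorMatrix A L B Bt).graph ↔ ∃ h : u ∈ A.domain, L ⟨u, h⟩ = x ∧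
      A ⟨u, h⟩ = w ∧ B ⟨u, h⟩ + Bt x = z := by
  rw [mem_graph_iff_exists]
  constructor
  · rintro ⟨⟨h1, h2⟩, h3⟩
    exact ⟨h1, h2, Prod.ext_iff.1 h3⟩
  · rintro ⟨h1, h2, h3⟩
    exact ⟨⟨h1, h2⟩, Prod.ext_iff.2 h3⟩

variable [CompleteSpace X] [CompleteSpace dX]

/-- Closed graph theorem: on `ker (μ - A)` the column operator acts as `(μ, L)`, so its closedness
keeps limits in that kernel, where `L` is injective. -/
theorem exists_dirichlet_clm (hAL : (column A L).IsClosed) :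
    ∃ D : dX →L[ℂ] X, ∀ x, D x = dirichlet A L hL hμ x := by
  let D : dX →ₗ[ℂ] X := A.domain.subtype ∘ₗ dirichlet A L hL hμ
  refine ⟨⟨D, D.continuous_of_seq_closed_graph fun u x y hu hy => ?_⟩, fun x => rfl⟩
  have h1 : (y, (μ • y, x)) ∈ (column A L).graph :=
    IsClosed.mem_of_tendsto hAL (hy.prodMk_nhds ((hy.const_smul μ).prodMk_nhds hu))
      (Eventually.of_forall fun n => mem_column_graph.2
        ⟨(dirichlet A L hL hμ (u n)).2, apply_dirichlet hL hμ (u n),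
          boundary_dirichlet hL hμ (u n)⟩)
  obtain ⟨h2, h3, h4⟩ := mem_column_graph.1 h1
  have h5 := (bijective_restrict_eigenKer A L hL hμ).1
    (a₁ := ⟨⟨y, h2⟩, sub_eq_zero.2 h3.symm⟩)
    (a₂ := ⟨dirichlet A L hL hμ x, sub_eq_zero.2 (apply_dirichlet hL hμ x).symm⟩)
    (h4.trans (boundary_dirichlet hL hμ x).symm)
  exact congrArg (fun w : eigenKer A μ => ((w : A.domain) : X)) h5

omit [CompleteSpace X] in
-- Makes the Dirichlet operator bounded into `Y`, as the phase space isomorphism requires.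
theorem exists_lift_clm {Y : Type*} [NormedAddCommGroup Y] [NormedSpace ℂ Y] [CompleteSpace Y]
    {i : Y →L[ℂ] X} (hi : Function.Injective i) (D : dX →L[ℂ] X)
    (hD : ∀ x, D x ∈ Set.range i) : ∃ D' : dX →L[ℂ] Y, ∀ x, i (D' x) = D x := by
  choose g hg using hD
  let D' : dX →ₗ[ℂ] Y :=
    { toFun := g
      map_add' := fun x y => hi (by simp [hg])
      map_smul' := fun c x => hi (by simp [hg]) }
  refine ⟨⟨D', D'.continuous_of_seq_closed_graph fun u x y hu hy => hi ?_⟩, hg⟩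
  refine (tendsto_nhds_unique (((i.continuous.tendsto y).comp hy).congr fun n => hg (u n))
    ((D.continuous.tendsto x).comp hu)).trans (hg x).symm

omit [CompleteSpace X] [CompleteSpace dX] in
theorem exists_feedback_dirichlet_clm {B : A.domain →ₗ[ℂ] dX}
    (hB : ∃ c : ℝ, ∀ u : A.domain, ‖B u‖ ≤ c * (‖(u : X)‖ + ‖A u‖ + ‖L u‖))
    {D : dX →L[ℂ] X} (hD : ∀ x, D x = dirichlet A L hL hμ x) :
    ∃ N : dX →L[ℂ] dX, ∀ x, N x = B (dirichlet A L hL hμ x) := by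
  obtain ⟨c, hc⟩ := hB
  refine ⟨(B ∘ₗ dirichlet A L hL hμ).mkContinuous (|c| * (‖D‖ + ‖μ‖ * ‖D‖ + 1)) fun x => ?_,
    fun x => rfl⟩
  refine (hc _).trans ?_
  rw [apply_dirichlet, boundary_dirichlet, ← hD, norm_smul, mul_assoc]
  have h1 : ‖D x‖ ≤ ‖D‖ * ‖x‖ := D.le_opNorm x
  calc c * (‖D x‖ + ‖μ‖ * ‖D x‖ + ‖x‖) ≤ |c| * (‖D x‖ + ‖μ‖ * ‖D x‖ + ‖x‖) := by
        gcongr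
        exact le_abs_self c
    _ ≤ |c| * (‖D‖ * ‖x‖ + ‖μ‖ * (‖D‖ * ‖x‖) + ‖x‖) := by gcongr
    _ = _ := by ring

/-- Closed graph theorem for `B R`: since `A₀ R y = ω R y - y + D B R y`, closedness of `A₀`
identifies `D z` with `D B R x` for a limit `z` of `B R u_n`, and `L` cancels `D`. -/
theorem exists_feedback_resolvent_clm {B : A.domain →ₗ[ℂ] dX}
    (hA₀ : (restrictKer A L).IsClosed) {D : dX →L[ℂ] X}
    (hD : ∀ x, D x = dirichlet A L hL hμ x) (ω : ℝ) (R : X →L[ℂ] X)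
    (hR : ∀ y, (R y, ω • R y - y) ∈ (perturbed A L hL B hμ).graph) :
    ∃ Q : X →L[ℂ] dX, ∀ y (h : R y ∈ (perturbed A L hL B hμ).domain),
      Q y = (B ∘ₗ Submodule.inclusion (kerDomain_le A L)) ⟨R y, h⟩ := by
  let g : X →ₗ[ℂ] dX := B ∘ₗ
    (R : X →ₗ[ℂ] X).codRestrict A.domain fun y => (mem_perturbed_graph hL hμ |>.1 (hR y)).1
  have hg : ∀ y (h : R y ∈ A.domain), g y = B ⟨R y, h⟩ := fun _ _ => rfl
  have hRg : ∀ y, ∃ h : R y ∈ A.domain, L ⟨R y, h⟩ = 0 ∧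
      A ⟨R y, h⟩ = ω • R y - y + D (g y) := fun y => by
    obtain ⟨h1, h2, h3⟩ := (mem_perturbed_graph hL hμ).1 (hR y)
    refine ⟨h1, h2, ?_⟩
    rw [hD, hg y h1, ← h3, sub_add_cancel]
  refine ⟨⟨g, g.continuous_of_seq_closed_graph fun u x z hu hz => ?_⟩, fun _ _ => rfl⟩
  have hRu := (R.continuous.tendsto x).comp hu
  have h1 : (R x, ω • R x - x + D z) ∈ (restrictKer A L).graph :=
    IsClosed.mem_of_tendsto hA₀
      (hRu.prodMk_nhds (((hRu.const_smul ω).sub hu).add ((D.continuous.tendsto z).comp hz)))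
      (Eventually.of_forall fun n => mem_restrictKer_graph.2 (hRg (u n)))
  obtain ⟨h2, -, h3⟩ := mem_restrictKer_graph.1 h1
  obtain ⟨h4, -, h5⟩ := hRg x
  have h6 := add_left_cancel (h3.symm.trans h5)
  rw [hD, hD] at h6
  have h7 := congrArg L (Subtype.ext h6)
  rwa [boundary_dirichlet, boundary_dirichlet] at h7

end Dirichlet

/-! ### The coupled space as a product. -/

section Coupled

variable {X Y V dX : Type*}
    [NormedAddCommGroup X] [NormedSpace ℂ X] [CompleteSpace X]
    [NormedAddCommGroup Y] [NormedSpace ℂ Y] [CompleteSpace Y]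
    [NormedAddCommGroup V] [NormedSpace ℂ V] [CompleteSpace V]
    [NormedAddCommGroup dX] [NormedSpace ℂ dX] [CompleteSpace dX]

/-- A bounded right inverse of the boundary operator identifies `V × ∂X` with the coupled
space. -/
theorem exists_equiv_coupledSpace {j : V →L[ℂ] Y} (hj : Function.Injective j)
    {L : Y →L[ℂ] dX} (hker : ∀ y : Y, L y = 0 ↔ y ∈ Set.range j) {D : dX →L[ℂ] Y}
    (hD : ∀ x, L (D x) = x) :
    ∃ Φ : (V × dX) ≃L[ℂ] coupledSpace L, ∀ v x, (Φ (v, x) : Y × dX) = (j v + D x, x) := by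
  let φ : V × dX →L[ℂ] coupledSpace L :=
    (((j.comp (ContinuousLinearMap.fst ℂ V dX) + D.comp (ContinuousLinearMap.snd ℂ V dX)).prod
      (ContinuousLinearMap.snd ℂ V dX))).codRestrict (coupledSpace L) fun p => by
        change L (j p.1 + D p.2) = p.2
        rw [map_add, hD, (hker _).2 ⟨p.1, rfl⟩, zero_add]
  have hφ : ∀ v x, (φ (v, x) : Y × dX) = (j v + D x, x) := fun _ _ => rfl
  refine ⟨ContinuousLinearEquiv.ofBijective φ (LinearMap.ker_eq_bot.2 ?_)
    (LinearMap.range_eq_top.2 ?_), hφ⟩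
  · rintro ⟨v, x⟩ ⟨w, z⟩ h
    obtain ⟨h1, h2⟩ := Prod.ext_iff.1 ((hφ v x).symm.trans ((congrArg Subtype.val h).trans
      (hφ w z)))
    change x = z at h2
    change j v + D x = j w + D z at h1
    subst h2
    rw [hj (add_right_cancel h1)]
  · rintro ⟨⟨y, x⟩, hy⟩
    change L y = x at hy
    obtain ⟨v, hv⟩ := (hker (y - D x)).1 (by rw [map_sub, hD, hy, sub_self])
    exact ⟨(v, x), Subtype.ext ((hφ v x).trans (by rw [hv, sub_add_cancel]))⟩

end Coupled

end AIBVP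

/-! ### Decoupling the boundary condition: the main theorem. -/

theorem theorem5p2
    {X Y V dX : Type*}
    [NormedAddCommGroup X] [NormedSpace ℂ X] [CompleteSpace X]
    [NormedAddCommGroup Y] [NormedSpace ℂ Y] [CompleteSpace Y]
    [NormedAddCommGroup V] [NormedSpace ℂ V] [CompleteSpace V]
    [NormedAddCommGroup dX] [NormedSpace ℂ dX] [CompleteSpace dX]
    -- the continuous embedding of `Y` into `X`
    (i : Y →L[ℂ] X) (hi : Function.Injective i)
    -- the operators `A` and `L`
    (A : X →ₗ.[ℂ] X) (hAY : ∀ u ∈ A.domain, u ∈ Set.range i)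
    (L : A.domain →ₗ[ℂ] dX) (hL : Function.Surjective L)
    (hA₀_closed : (AIBVP.restrictKer A L).IsClosed)
    (hA₀_dense : Dense ((AIBVP.restrictKer A L).domain : Set X))
    (hA₀_res : (AIBVP.resolventSet (AIBVP.restrictKer A L)).Nonempty)
    (hAL_closed : (AIBVP.column A L).IsClosed)
    -- the feedback operators; `B` is bounded for the graph norm of the column operator
    (B : A.domain →ₗ[ℂ] dX)
    (hB : ∃ c : ℝ, ∀ u : A.domain, ‖B u‖ ≤ c * (‖(u : X)‖ + ‖A u‖ + ‖L u‖))
    (Bt : dX →L[ℂ] dX)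
    -- the continuous embedding of `V` into `Y`
    (j : V →L[ℂ] Y) (hj : Function.Injective j)
    -- the bounded extension of `L` to `Y`, whose kernel is `V`
    (Lext : Y →L[ℂ] dX)
    (hLext : ∀ (y : Y) (hy : i y ∈ A.domain), Lext y = L ⟨i y, hy⟩)
    (hker : ∀ y : Y, Lext y = 0 ↔ y ∈ Set.range j) :
    ∀ (μ : ℂ) (hμ : μ ∈ AIBVP.resolventSet (AIBVP.restrictKer A L)),
      AIBVP.GeneratesCosineWithPhaseSpace
          (AIBVP.operatorMatrix A L B Bt) (AIBVP.coupledEmbedding i Lext) ↔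
        AIBVP.GeneratesCosineWithPhaseSpace
          (AIBVP.perturbed A L hL B hμ) (i.comp j) := by
  intro μ hμ
  obtain ⟨D, hD⟩ := AIBVP.exists_dirichlet_clm hL hμ hAL_closed
  have hDmem : ∀ x, D x ∈ A.domain := fun x => by
    rw [hD]
    exact (AIBVP.dirichlet A L hL hμ x).2
  have hDeq : ∀ x, (⟨D x, hDmem x⟩ : A.domain) = AIBVP.dirichlet A L hL hμ x := fun x =>
    Subtype.ext (hD x)
  obtain ⟨DY, hDY⟩ := AIBVP.exists_lift_clm hi D fun x => hAY _ (hDmem x)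
  obtain ⟨N, hN⟩ := AIBVP.exists_feedback_dirichlet_clm hL hμ hB hD
  have hLDY : ∀ x, Lext (DY x) = x := fun x => by
    rw [hLext (DY x) ((hDY x).symm ▸ hDmem x)]
    exact (congrArg L (Subtype.ext ((hDY x).trans (hD x)))).trans
      (AIBVP.boundary_dirichlet hL hμ x)
  obtain ⟨Φ, hΦ⟩ := AIBVP.exists_equiv_coupledSpace hj hker hLDY
  let B₀ : (AIBVP.perturbed A L hL B hμ).domain →ₗ[ℂ] dX :=
    B ∘ₗ Submodule.inclusion (AIBVP.kerDomain_le A L)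
  refine Iff.trans ?_ (AIBVP.generatesCosineWithPhaseSpace_firstColumn_iff (B := B₀)
    (AIBVP.exists_feedback_resolvent_clm hL hμ hA₀_closed hD))
  -- The second column of the conjugated operator matrix.
  let Q : X × dX →L[ℂ] X × dX := ((μ • D - D.comp (N + Bt)).prod (N + Bt)).comp
    (ContinuousLinearMap.snd ℂ X dX)
  have hQ : ∀ v x, Q (v, x) = (μ • D x - D (N x + Bt x), N x + Bt x) := fun _ _ => rfl
  refine Iff.trans ?_ (AIBVP.GeneratesCosineWithPhaseSpace.perturb_iff Q
    fun x y => AIBVP.mem_vadd_graph Q).symm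
  let f : X × dX →L[ℂ] X × dX := (ContinuousLinearMap.fst ℂ X dX +
    D.comp (ContinuousLinearMap.snd ℂ X dX)).prod (ContinuousLinearMap.snd ℂ X dX)
  let g : X × dX →L[ℂ] X × dX := (ContinuousLinearMap.fst ℂ X dX -
    D.comp (ContinuousLinearMap.snd ℂ X dX)).prod (ContinuousLinearMap.snd ℂ X dX)
  have hf : ∀ v x, f (v, x) = (v + D x, x) := fun _ _ => rfl
  have hg : ∀ v x, g (v, x) = (v - D x, x) := fun _ _ => rfl
  let Ψ : (X × dX) ≃L[ℂ] X × dX := ContinuousLinearEquiv.equivOfInverse f g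
    (fun ⟨v, x⟩ => by rw [hf, hg, add_sub_cancel_right])
    (fun ⟨v, x⟩ => by rw [hg, hf, sub_add_cancel])
  have hΨ : ∀ v x, Ψ (v, x) = (v + D x, x) := hf
  -- `Φ` is the same shear on the phase spaces; the two goals are compatibility with the embeddings
  -- and the conjugation identity.
  refine (AIBVP.GeneratesCosineWithPhaseSpace.similar_iff Ψ Φ ?_ ?_).symm
  · rintro ⟨v, x⟩
    change (i (Φ (v, x) : Y × dX).1, (Φ (v, x) : Y × dX).2) = Ψ (i (j v), x)
    rw [hΦ, hΨ, map_add, hDY]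
  · rintro ⟨v, x⟩ ⟨y, b⟩
    rw [AIBVP.mem_vadd_graph, hQ, hΨ, hΨ, Prod.mk_sub_mk]
    have hadd : ∀ h : v ∈ A.domain, (⟨v + D x, A.domain.add_mem h (hDmem x)⟩ : A.domain) =
        ⟨v, h⟩ + AIBVP.dirichlet A L hL hμ x := fun h => by
      rw [← hDeq]
      rfl
    rw [AIBVP.mem_operatorMatrix_graph, AIBVP.mem_firstColumn_graph]
    constructor
    · rintro ⟨h1, h2, h3⟩
      obtain ⟨h, h4, h5⟩ := (AIBVP.mem_perturbed_graph hL hμ).1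
        (AIBVP.mem_graph_iff_exists.2 ⟨h1, h2⟩)
      change B ⟨v, h⟩ = b - (N x + Bt x) at h3
      refine ⟨A.domain.add_mem h (hDmem x), ?_⟩
      rw [hadd h, map_add, map_add, h4, A.map_add, AIBVP.boundary_dirichlet,
        AIBVP.apply_dirichlet, ← hD, ← hN, zero_add]
      refine ⟨rfl, ?_, ?_⟩
      · rw [← hD, h3, map_sub] at h5
        rw [sub_eq_iff_eq_add.1 h5]
        abel
      · rw [h3, add_assoc, sub_add_cancel]
    · rintro ⟨h1, h2⟩
      have h : v ∈ A.domain := by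
        have := A.domain.sub_mem h1 (hDmem x)
        rwa [add_sub_cancel_right] at this
      rw [hadd h, map_add, map_add, A.map_add, AIBVP.boundary_dirichlet,
        AIBVP.apply_dirichlet, ← hD, ← hN] at h2
      obtain ⟨h3, h4, h5⟩ := h2
      have h6 : B ⟨v, h⟩ = b - (N x + Bt x) := by rw [← h5]; abel
      obtain ⟨h7, h8⟩ := AIBVP.mem_graph_iff_exists.1
        ((AIBVP.mem_perturbed_graph hL hμ (B := B)).2 ⟨h, add_eq_right.1 h3, rfl⟩)
      refine ⟨h7, h8.trans ?_, h6⟩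
      rw [← hD, h6, eq_sub_of_add_eq h4, map_sub]
      abel
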